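/- Let $\mathbb{F}_q$ be a finite field, and for $n\ge 0$ let $C_n(q)=C(\mathfrak{gl}_n(\mathbb{F}_q))$ be the complex vector space of functions $f:\mathfrak{gl}_n(\mathbb{F}_q)\to\mathbb{C}$ with $f(gxg^{-1})=f(x)$ for all $g\in \mathrm{GL}_n(\mathbb{F}_q)$, $x\in\mathfrak{gl}_n(\mathbb{F}_q)$ (so $\mathfrak{gl}_0=\{0\}$ and $C_0(q)=\mathbb{C}$). Put $C(q)=\bigoplus_{n\ge 0}C_n(q)$. For $k+l=n$ let $C(\mathfrak{gl}_k\times\mathfrak{gl}_l)$ be the space of complex functions on $\mathfrak{gl}_k(\mathbb{F}_q)\times\mathfrak{gl}_l(\mathbb{F}_q)$ invariant under conjugation by $\mathrm{GL}_k(\mathbb{F}_q)\times\mathrm{GL}_l(\mathbb{F}_q)$, identified with $C_k(q)\otimes_{\mathbb{C}} C_l(q)$ through $f\otimes g\mapsto \big((x,y)\mapsto f(x)g(y)\big)$. Let $P_{k,l}\subseteq \mathrm{GL}_n(\mathbb{F}_q)$ and $\mathfrak{p}_{k,l}\subseteq\mathfrak{gl}_n(\mathbb{F}_q)$ be the block upper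 triangular matrices with diagonal blocks of sizes $k,l$, and let $\pi:\mathfrak{p}_{k,l}\to\mathfrak{gl}_k(\mathbb{F}_q)\times\mathfrak{gl}_l(\mathbb{F}_q)$ be the projection to the diagonal blocks. Harish-Chandra induction $R_{k,l}^n: C(\mathfrak{gl}_k\times\mathfrak{gl}_l)\to C_n(q)$ and restriction ${}^*R_{k,l}^n: C_n(q)\to C(\mathfrak{gl}_k\times\mathfrak{gl}_l)$ are $$R_{k,l}^n(f)(x)=\frac{1}{|P_{k,l}|}\sum_{\substack{g\in \mathrm{GL}_n(\mathbb{F}_q)\\ gxg^{-1}\in\mathfrak{p}_{k,l}}} f\big(\pi(gxg^{-1})\big),\qquad {}^*R_{k,l}^n(f)(x,y)=\frac{1}{q^{kl}}\sum_{u\in M_{k\times l}(\mathbb{F}_q)} f\begin{pmatrix}x&u\\0&y\end{pmatrix}.$$ Let $m:C(q)\otimes C(q)\to C(q)$ be the sum of the maps $R_{k,l}^{k+l}$ $(k,l\ge 0)$, let $m^*:C(q)\to C(q)\otimes C(q)$ be given on $C_n(q)$ by $\sum_{k+l=n}{}^*R_{k,l}^n$ (sum over $k,l\ge 0$), and let $e:\mathbb{C}=C_0(q)\to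 C(q)$ and $e^*:C(q)\to C_0(q)=\mathbb{C}$ be the natural embedding and projection. Proposition. With product $m$, coproduct $m^*$, unit $e$ and counit $e^*$, the space $C(q)=\bigoplus_n C_n(q)$ is a connected graded Hopf algebra over $\mathbb{C}$ (that is, it is a Hopf algebra whose structure maps, including the antipode, preserve degree, and $e$ maps $\mathbb{C}$ isomorphically onto the degree-zero part). Moreover, it is both commutative and cocommutative. -/

import Mathlib

open scoped TensorProduct DirectSum

universe u

noncomputable section

namespace GLInv

/-! ### Connected graded Hopf algebras -/

/-- A Hopf algebra `H` over `k` with a family `𝒜` of subspaces is a connected graded Hopf algebra: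
`H` is the direct sum of the `𝒜 n` (`n ∈ ℕ`), all structure maps preserve degrees
(with `(H ⊗ H)ₙ = ⨁_{i+j=n} 𝒜 i ⊗ 𝒜 j` and `k` in degree `0`), and the unit map `k → 𝒜 0`
is bijective. -/
structure IsConnectedGradedHopf (k : Type*) {H : Type*} [Field k] [Ring H] [HopfAlgebra k H]
    (𝒜 : ℕ → Submodule k H) : Prop where
  isInternal : DirectSum.IsInternal 𝒜
  one_mem : (1 : H) ∈ 𝒜 0
  mul_mem : ∀ ⦃i j : ℕ⦄ ⦃a b : H⦄, a ∈ 𝒜 i → b ∈ 𝒜 j → a * b ∈ 𝒜 (i + j)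
  comul_mem : ∀ ⦃n : ℕ⦄ ⦃a : H⦄, a ∈ 𝒜 n → Coalgebra.comul (R := k) a ∈
    ⨆ p ∈ Finset.HasAntidiagonal.antidiagonal n,
      LinearMap.range (TensorProduct.map (𝒜 p.1).subtype (𝒜 p.2).subtype)
  counit_eq_zero : ∀ ⦃n : ℕ⦄ ⦃a : H⦄, n ≠ 0 → a ∈ 𝒜 n → Coalgebra.counit (R := k) a = 0
  antipode_mem : ∀ ⦃n : ℕ⦄ ⦃a : H⦄, a ∈ 𝒜 n → HopfAlgebra.antipode k a ∈ 𝒜 n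
  unit_injective : Function.Injective (algebraMap k H)
  unit_range : LinearMap.range (Algebra.linearMap k H) = 𝒜 0

variable (F : Type*) [Field F]

/-- `𝔤𝔩ₙ(F)`. -/
abbrev gl (n : ℕ) : Type _ := Matrix (Fin n) (Fin n) F

/-- `C(𝔤𝔩ₙ(F))`: complex functions on `𝔤𝔩ₙ(F)` invariant under the adjoint action of `GLₙ(F)`. -/
def Inv (n : ℕ) : Submodule ℂ (gl F n → ℂ) where
  carrier := {f | ∀ (g : GL (Fin n) F) (x : gl F n), f (g.val * x * g⁻¹.val) = f x}
  add_mem' hf hg a x := by simp only [Pi.add_apply, hf a x, hg a x]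
  zero_mem' _ _ := rfl
  smul_mem' c f hf a x := by simp only [Pi.smul_apply, hf a x]

/-- `C(𝔤𝔩ₖ(F) × 𝔤𝔩ₗ(F))`: complex functions on the Lie algebra of the block-diagonal subgroup
`GLₖ × GLₗ`, invariant under its adjoint action. -/
def InvLevi (k l : ℕ) : Submodule ℂ (gl F k × gl F l → ℂ) where
  carrier := {f | ∀ (a : GL (Fin k) F) (b : GL (Fin l) F) (x : gl F k) (y : gl F l),
    f (a.val * x * a⁻¹.val, b.val * y * b⁻¹.val) = f (x, y)}
  add_mem' hf hg a b x y := by simp only [Pi.add_apply, hf a b x y, hg a b x y]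
  zero_mem' _ _ _ _ := rfl
  smul_mem' c f hf a b x y := by simp only [Pi.smul_apply, hf a b x y]

variable {F}

theorem Inv.eq_of_isConj {n : ℕ} (f : Inv F n) {x y : gl F n} (h : IsConj x y) :
    f.1 x = f.1 y := by
  obtain ⟨g, hg⟩ := h
  have : y = g.val * x * g⁻¹.val := by
    rw [hg.eq, mul_assoc, Units.mul_inv, mul_one]
  rw [this]
  exact (f.2 g x).symm

/-! ### The identification `C(𝔤𝔩ₖ) ⊗ C(𝔤𝔩ₗ) ≅ C(𝔤𝔩ₖ × 𝔤𝔩ₗ)` -/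

/-- The external product `f ⊠ g : (x, y) ↦ f x * g y`. -/
def box (k l : ℕ) : Inv F k →ₗ[ℂ] Inv F l →ₗ[ℂ] InvLevi F k l :=
  LinearMap.mk₂ ℂ
    (fun f g => ⟨fun p => f.1 p.1 * g.1 p.2, fun a b x y => by
      show f.1 _ * g.1 _ = f.1 _ * g.1 _
      rw [f.2 a x, g.2 b y]⟩)
    (fun f f' g => Subtype.ext <| funext fun p => add_mul _ _ _)
    (fun c f g => Subtype.ext <| funext fun p => mul_assoc _ _ _)
    (fun f g g' => Subtype.ext <| funext fun p => mul_add _ _ _)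
    (fun c f g => Subtype.ext <| funext fun p => mul_left_comm _ _ _)

theorem box_apply {k l : ℕ} (f : Inv F k) (g : Inv F l) (x : gl F k) (y : gl F l) :
    (box k l f g).1 (x, y) = f.1 x * g.1 y := rfl

open scoped Classical in
/-- The indicator function of a conjugacy class. -/
def classInd {k : ℕ} (c : ConjClasses (gl F k)) : Inv F k :=
  ⟨fun x => if ConjClasses.mk x = c then 1 else 0, fun g x => by
    have : ConjClasses.mk (g.val * x * g⁻¹.val) = ConjClasses.mk x :=
      ConjClasses.mk_eq_mk_iff_isConj.2 (IsConj.symm ⟨g, by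
        show g.val * x = g.val * x * g⁻¹.val * g.val
        rw [mul_assoc _ g⁻¹.val, Units.inv_mul, mul_one]⟩)
    simp only [this]⟩

/-- The partial function `y ↦ f (x, y)`. -/
def slice {k l : ℕ} (x : gl F k) : InvLevi F k l →ₗ[ℂ] Inv F l where
  toFun f := ⟨fun y => f.1 (x, y), fun b y => by simpa using f.2 1 b x y⟩
  map_add' _ _ := rfl
  map_smul' _ _ := rfl

/-! ### Block matrices -/

/-- The index set of size `n = k + l`, split into the first `k` and the last `l` indices. -/
def split {k l n : ℕ} (h : k + l = n) : Fin k ⊕ Fin l ≃ Fin n :=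
  finSumFinEquiv.trans (finCongr h)

/-- The `n × n` matrix with block rows `(x, u)` and `(0, y)`. -/
def blockUpper {k l n : ℕ} (h : k + l = n) (x : gl F k) (u : Matrix (Fin k) (Fin l) F)
    (y : gl F l) : gl F n :=
  Matrix.reindex (split h) (split h) (Matrix.fromBlocks x u 0 y)

theorem blockUpper_conj {k l n : ℕ} (h : k + l = n) (a : GL (Fin k) F) (b : GL (Fin l) F) :
    ∃ g : GL (Fin n) F, ∀ x u y, g.val * blockUpper h x u y * g⁻¹.val =
      blockUpper h (a.val * x * a⁻¹.val) (a.val * u * b⁻¹.val) (b.val * y * b⁻¹.val) := by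
  have key : ∀ (x x' : gl F k) (u u') (y y' : gl F l),
      blockUpper h x u y * blockUpper h x' u' y' =
        blockUpper h (x * x') (x * u' + u * y') (y * y') := by
    intro x x' u u' y y'
    simp [blockUpper, Matrix.submatrix_mul_equiv, Matrix.fromBlocks_multiply]
  have one : blockUpper h (1 : gl F k) 0 (1 : gl F l) = 1 := by
    simp [blockUpper, Matrix.fromBlocks_one]
  refine ⟨⟨blockUpper h a.val 0 b.val, blockUpper h a⁻¹.val 0 b⁻¹.val, ?_, ?_⟩, ?_⟩
  · rw [key]; simp [one]
  · rw [key]; simp [one]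
  · intro x u y
    show blockUpper h a.val 0 b.val * _ * blockUpper h a⁻¹.val 0 b⁻¹.val = _
    rw [key, key]
    simp

variable [Fintype F]

/-! ### The inverse of the external product -/

instance (k : ℕ) : Fintype (ConjClasses (gl F k)) :=
  @Fintype.ofFinite _ (Quotient.finite _)

/-- The inverse of the external product: `f ↦ ∑_c 1_c ⊗ f(x_c, ·)`, with `c` running through the
conjugacy classes of `𝔤𝔩ₖ(F)` and `x_c ∈ c` a representative. -/
def unbox (k l : ℕ) : InvLevi F k l →ₗ[ℂ] Inv F k ⊗[ℂ] Inv F l :=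
  ∑ c : ConjClasses (gl F k), (TensorProduct.mk ℂ (Inv F k) (Inv F l) (classInd c)) ∘ₗ
    slice (Quotient.out c)

theorem sum_classInd {k : ℕ} (f : Inv F k) :
    ∑ c : ConjClasses (gl F k), f.1 (Quotient.out c) • classInd c = f := by
  classical
  refine Subtype.ext <| funext fun x => ?_
  rw [AddSubmonoidClass.coe_finsetSum, Finset.sum_apply,
    Finset.sum_eq_single (ConjClasses.mk x)]
  · have h : f.1 (Quotient.out (ConjClasses.mk x)) = f.1 x :=
      Inv.eq_of_isConj f (ConjClasses.mk_eq_mk_iff_isConj.1 (Quotient.out_eq _))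
    simp [classInd, h]
  · intro c _ hc
    simp [classInd, hc.symm]
  · simp

/-- The external product as an isomorphism `C(𝔤𝔩ₖ) ⊗ C(𝔤𝔩ₗ) ≅ C(𝔤𝔩ₖ × 𝔤𝔩ₗ)`. -/
def boxEquiv (k l : ℕ) : Inv F k ⊗[ℂ] Inv F l ≃ₗ[ℂ] InvLevi F k l :=
  LinearEquiv.ofLinearMap (TensorProduct.lift (box k l)) (unbox k l)
    (by
      classical
      refine LinearMap.ext fun f => Subtype.ext <| funext fun ⟨x, y⟩ => ?_
      simp only [unbox, LinearMap.comp_apply, LinearMap.sum_apply, map_sum,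
        TensorProduct.mk_apply, TensorProduct.lift.tmul, LinearMap.id_apply]
      rw [AddSubmonoidClass.coe_finsetSum, Finset.sum_apply]
      simp only [box_apply]
      let g : Inv F k := ⟨fun x => f.1 (x, y), fun a x => by simpa using f.2 a 1 x y⟩
      have h := congrArg (fun t : Inv F k => t.1 x) (sum_classInd g)
      simp only [AddSubmonoidClass.coe_finsetSum, Finset.sum_apply] at h
      refine Eq.trans (Finset.sum_congr rfl fun c _ => ?_) h
      exact mul_comm _ _)
    (by
      refine TensorProduct.ext' fun f g => ?_
      simp only [unbox, LinearMap.comp_apply, LinearMap.sum_apply, TensorProduct.mk_apply,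
        TensorProduct.lift.tmul, LinearMap.id_apply]
      have h : ∀ c : ConjClasses (gl F k),
          slice (Quotient.out c) (box k l f g) = f.1 (Quotient.out c) • g := fun c => rfl
      simp only [h, TensorProduct.tmul_smul]
      simp only [TensorProduct.smul_tmul', ← TensorProduct.sum_tmul, sum_classInd])

/-! ### Harish-Chandra induction and restriction for the block-diagonal Levi in `GL_{k+l}` -/

variable [DecidableEq F]

/-- The four blocks of an `n × n` matrix, as a matrix indexed by `Fin k ⊕ Fin l`. -/
def blocks {k l n : ℕ} (h : k + l = n) (x : gl F n) : Matrix (Fin k ⊕ Fin l) (Fin k ⊕ Fin l) F :=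
  Matrix.reindex (split h).symm (split h).symm x

/-- Membership in the parabolic subalgebra of block upper triangular matrices. -/
def InPar {k l n : ℕ} (h : k + l = n) (x : gl F n) : Prop :=
  (blocks h x).toBlocks₂₁ = 0

instance {k l n : ℕ} (h : k + l = n) (x : gl F n) : Decidable (InPar h x) :=
  inferInstanceAs (Decidable ((blocks h x).toBlocks₂₁ = 0))

/-- The projection of the parabolic subalgebra onto the Levi subalgebra `𝔤𝔩ₖ × 𝔤𝔩ₗ`. -/
def proj {k l n : ℕ} (h : k + l = n) (x : gl F n) : gl F k × gl F l :=
  ((blocks h x).toBlocks₁₁, (blocks h x).toBlocks₂₂)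

/-- Harish-Chandra induction
`R(f)(x) = |P|⁻¹ ∑_{g ∈ GLₙ(F), g x g⁻¹ ∈ 𝔭} f(π(g x g⁻¹))` as a function of `x`, where `P` is the
group of invertible block upper triangular matrices. -/
def hcIndFun {k l n : ℕ} (h : k + l = n) (f : gl F k × gl F l → ℂ) (x : gl F n) : ℂ :=
  (Nat.card {g : GL (Fin n) F // InPar h g.val} : ℂ)⁻¹ *
    ∑ g : GL (Fin n) F,
      if InPar h (g.val * x * g⁻¹.val) then f (proj h (g.val * x * g⁻¹.val)) else 0

theorem hcIndFun_conj {k l n : ℕ} (h : k + l = n) (f : gl F k × gl F l → ℂ) (a : GL (Fin n) F)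
    (x : gl F n) : hcIndFun h f (a.val * x * a⁻¹.val) = hcIndFun h f x := by
  have key : ∀ g : GL (Fin n) F, g.val * (a.val * x * a⁻¹.val) * g⁻¹.val =
      (g * a).val * x * (g * a)⁻¹.val := fun g => by
    rw [mul_inv_rev, Units.val_mul, Units.val_mul]
    simp only [mul_assoc]
  unfold hcIndFun
  simp only [key]
  congr 1
  exact Equiv.sum_comp (Equiv.mulRight a) fun g : GL (Fin n) F =>
    if InPar h (g.val * x * g⁻¹.val) then f (proj h (g.val * x * g⁻¹.val)) else 0

theorem hcIndFun_add {k l n : ℕ} (h : k + l = n) (f f' : gl F k × gl F l → ℂ) :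
    hcIndFun h (f + f') = hcIndFun h f + hcIndFun h f' := by
  funext x
  simp only [Pi.add_apply, hcIndFun]
  rw [← mul_add, ← Finset.sum_add_distrib]
  congr 1
  refine Finset.sum_congr rfl fun a _ => ?_
  split_ifs <;> simp

theorem hcIndFun_smul {k l n : ℕ} (h : k + l = n) (c : ℂ) (f : gl F k × gl F l → ℂ) :
    hcIndFun h (c • f) = c • hcIndFun h f := by
  funext x
  simp only [Pi.smul_apply, hcIndFun, smul_eq_mul]
  simp only [Finset.mul_sum]
  refine Finset.sum_congr rfl fun a _ => ?_
  split_ifs <;> simp [mul_left_comm]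

/-- Harish-Chandra induction `C(𝔤𝔩ₖ × 𝔤𝔩ₗ) → C(𝔤𝔩ₙ)`, for `n = k + l`. -/
def hcInd {k l n : ℕ} (h : k + l = n) : InvLevi F k l →ₗ[ℂ] Inv F n where
  toFun f := ⟨hcIndFun h f.1, hcIndFun_conj h f.1⟩
  map_add' f g := Subtype.ext (hcIndFun_add h f.1 g.1)
  map_smul' c f := Subtype.ext (hcIndFun_smul h c f.1)

/-- Harish-Chandra restriction `*R(f)(x, y) = |U|⁻¹ ∑_{u ∈ 𝔲} f((x, y) + u)`, where `𝔲` is the space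
of strictly block upper triangular matrices, which has as many elements as the unipotent radical
`U = 1 + 𝔲`. -/
def hcRes {k l n : ℕ} (h : k + l = n) : Inv F n →ₗ[ℂ] InvLevi F k l where
  toFun f := ⟨fun p =>
    (Nat.card (Matrix (Fin k) (Fin l) F) : ℂ)⁻¹ *
      ∑ u : Matrix (Fin k) (Fin l) F, f.1 (blockUpper h p.1 u p.2),
    fun a b x y => by
      dsimp only
      congr 1
      obtain ⟨g, hg⟩ := blockUpper_conj h a b
      symm
      refine Fintype.sum_bijective (fun u => a.val * u * b⁻¹.val)
        (Function.bijective_iff_has_inverse.2 ⟨fun u => a⁻¹.val * u * b.val, fun u => ?_, fun u => ?_⟩)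
        _ _ fun u => ?_
      · show a⁻¹.val * (a.val * u * b⁻¹.val) * b.val = u
        rw [← Matrix.mul_assoc, ← Matrix.mul_assoc, Units.inv_mul, Matrix.one_mul,
          Matrix.mul_assoc, Units.inv_mul, Matrix.mul_one]
      · show a.val * (a⁻¹.val * u * b.val) * b⁻¹.val = u
        rw [← Matrix.mul_assoc, ← Matrix.mul_assoc, Units.mul_inv, Matrix.one_mul,
          Matrix.mul_assoc, Units.mul_inv, Matrix.mul_one]
      · rw [← hg, f.2 g]⟩
  map_add' f g := by
    refine Subtype.ext <| funext fun x => ?_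
    simp only [Submodule.coe_add, Pi.add_apply, ← mul_add, ← Finset.sum_add_distrib]
  map_smul' c f := by
    refine Subtype.ext <| funext fun x => ?_
    change (_ : ℂ) = c * (_ * _ : ℂ)
    rw [mul_left_comm, Finset.mul_sum]
    rfl

/-! ### The graded space `C(q)` and its operations -/

variable (F)

/-- `C(q) = ⨁ₙ C(𝔤𝔩ₙ(F))`. -/
abbrev CSpace : Type _ := ⨁ n : ℕ, Inv F n

/-- The degree-`n` component of `C(q)`. -/
def comp (n : ℕ) : Submodule ℂ (CSpace F) :=
  LinearMap.range (DirectSum.lof ℂ ℕ (fun n => Inv F n) n)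

/-- The product, given on `C(𝔤𝔩ₖ) ⊗ C(𝔤𝔩ₗ) ≅ C(𝔤𝔩ₖ × 𝔤𝔩ₗ)` by Harish-Chandra induction. -/
def mulMap : CSpace F ⊗[ℂ] CSpace F →ₗ[ℂ] CSpace F :=
  TensorProduct.lift <| DirectSum.toModule ℂ ℕ _ fun k => LinearMap.flip <|
    DirectSum.toModule ℂ ℕ _ fun l => LinearMap.flip <|
      TensorProduct.curry <|
        DirectSum.lof ℂ ℕ (fun n => Inv F n) (k + l) ∘ₗ hcInd rfl ∘ₗ (boxEquiv k l).toLinearMap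

/-- The coproduct, given on `C(𝔤𝔩ₙ)` by the sum over `k + l = n` of the Harish-Chandra
restrictions to `C(𝔤𝔩ₖ × 𝔤𝔩ₗ) ≅ C(𝔤𝔩ₖ) ⊗ C(𝔤𝔩ₗ)`. -/
def comulMap : CSpace F →ₗ[ℂ] CSpace F ⊗[ℂ] CSpace F :=
  DirectSum.toModule ℂ ℕ _ fun n => ∑ p : Finset.HasAntidiagonal.antidiagonal n,
    TensorProduct.map (DirectSum.lof ℂ ℕ (fun n => Inv F n) p.1.1)
      (DirectSum.lof ℂ ℕ (fun n => Inv F n) p.1.2) ∘ₗ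
        (boxEquiv p.1.1 p.1.2).symm.toLinearMap ∘ₗ hcRes (Finset.HasAntidiagonal.mem_antidiagonal.1 p.2)

/-- The identification `C(𝔤𝔩₀) = ℂ` (functions on the one-point space `𝔤𝔩₀ = {0}`). -/
def zeroEquiv : Inv F 0 ≃ₗ[ℂ] ℂ where
  toFun f := f.1 0
  map_add' _ _ := rfl
  map_smul' _ _ := rfl
  invFun c := ⟨fun _ => c, fun _ _ => rfl⟩
  left_inv f := Subtype.ext <| funext fun x => congrArg f.1 (Subsingleton.elim 0 x)
  right_inv _ := rfl

/-- The unit: the embedding of `ℂ = C(𝔤𝔩₀)`. -/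
def unitMap : ℂ →ₗ[ℂ] CSpace F :=
  DirectSum.lof ℂ ℕ (fun n => Inv F n) 0 ∘ₗ (zeroEquiv F).symm.toLinearMap

/-- The counit: the projection onto `C(𝔤𝔩₀) = ℂ`. -/
def counitMap : CSpace F →ₗ[ℂ] ℂ :=
  (zeroEquiv F).toLinearMap ∘ₗ DirectSum.component ℂ ℕ (fun n => Inv F n) 0

end GLInv

end

/-! Everything rests on one coproduct formula and one self-duality.

`ev` extends an element of `C(q)` to a function on square matrices indexed by any finite type, and
tensors are compared through their values at pairs or triples of matrices. In these terms the
coproduct of `φ` at `(x, y)` is the average of `φ` over all block matrices with diagonal `(x, y)`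
and lower left block zero (`ev₂_comulMap`). Coassociativity then says that two ways of averaging
over block triangular matrices with three diagonal blocks agree. Cocommutativity holds because a
square matrix is similar to its transpose (`exists_conj_eq_transpose`): transposing a block
triangular matrix and relabelling the indices exchanges the order of the diagonal blocks.

The bilinear form `⟨f, g⟩ = |GLₙ|⁻¹ ∑ f(x) g(x)` is nondegenerate and makes induction adjoint to
restriction (`pairing_mulMap`). Hence `a ↦ ⟨a, ·⟩` is an injective, multiplicative and unital map
into the convolution algebra of the dual of the coalgebra. Associativity, the unit laws and
commutativity of the product are pulled back along it; commutativity comes from cocommutativity.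

Multiplicativity of the coproduct becomes, after pairing with `c ⊗ d`, the identity `⟨ab, cd⟩ = ⟨Δa
Δb, c ⊗ d⟩`. This is the Mackey formula: the pairing of two induced functions splits over the double
cosets of two parabolic subgroups. These are indexed by the 2 × 2 tables `(i, j; m, r)` of natural
numbers with row sums `k, l` and column sums `k', l'` (`exists_eq_mul_perm_mul`, `position_unique`).
The contribution of a table is an integral over the intersection of the two parabolics, and it
factors through the restrictions of `a, b, c, d` (`Position.fourSum_eq`); the powers of `q` cancel.

Finally, the degree zero part is `ℂ`, so `1 - id` is locally nilpotent for convolution, and the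
geometric series `∑ (1 - id)ⁱ` is a degree-preserving antipode. -/

noncomputable section

namespace GLInv

/-! ### Tensors and separating families of functionals -/

section Separation

variable {k M N : Type*} [Field k] [AddCommMonoid M] [Module k M] [AddCommMonoid N] [Module k N]

/-- A tensor in `M ⊗ N` is determined by its contractions with a separating family of functionals
on `N`. -/
theorem tensor_ext_right {S : Type*} (s : S → N →ₗ[k] k) (hs : ∀ n, (∀ i, s i n = 0) → n = 0)
    {T T' : M ⊗[k] N}
    (h : ∀ i, TensorProduct.rid k M ((s i).lTensor M T) =
      TensorProduct.rid k M ((s i).lTensor M T')) : T = T' := by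
  classical
  -- Over a field the modules have negatives, so it suffices to show that a difference of tensors
  -- vanishes.
  let _ := Module.addCommMonoidToAddCommGroup k (M := M)
  let _ := Module.addCommMonoidToAddCommGroup k (M := N)
  rw [← sub_eq_zero]
  have h' : ∀ i, TensorProduct.rid k M ((s i).lTensor M (T - T')) = 0 := fun i => by
    rw [map_sub, map_sub, h i, sub_self]
  generalize T - T' = U at h'
  let b := Module.Basis.ofVectorSpace k M
  apply (TensorProduct.equivFinsuppOfBasisLeft (N := N) b).injective
  rw [map_zero]
  ext j
  refine hs _ fun i => ?_
  -- In a basis of `M` a tensor is a finitely supported family of elements of `N`. Applying `s i` to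
  -- the family gives the coordinates of the contraction.
  have key : ∀ V : M ⊗[k] N, s i (TensorProduct.equivFinsuppOfBasisLeft b V j) =
      b.repr (TensorProduct.rid k M ((s i).lTensor M V)) j := by
    intro V
    induction V with
    | zero => simp
    | add x y hx hy => simp only [map_add, Finsupp.add_apply, hx, hy]
    | tmul m n => simp [mul_comm]
  rw [key, h' i]
  simp

/-- A tensor in `M ⊗ N` is determined by the values of the products of functionals from separating
families on `M` and on `N`. -/
theorem tensor_ext {S S' : Type*} (s : S → M →ₗ[k] k) (s' : S' → N →ₗ[k] k)
    (hs : ∀ n, (∀ i, s i n = 0) → n = 0) (hs' : ∀ n, (∀ i, s' i n = 0) → n = 0)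
    {T T' : M ⊗[k] N}
    (h : ∀ i j, LinearMap.mul' k k (TensorProduct.map (s i) (s' j) T) =
      LinearMap.mul' k k (TensorProduct.map (s i) (s' j) T')) : T = T' := by
  let _ := Module.addCommMonoidToAddCommGroup k (M := M)
  refine tensor_ext_right s' hs' fun j => ?_
  rw [← sub_eq_zero]
  refine hs _ fun i => ?_
  have key : ∀ V : M ⊗[k] N, s i (TensorProduct.rid k M ((s' j).lTensor M V)) =
      LinearMap.mul' k k (TensorProduct.map (s i) (s' j) V) := by
    intro V
    induction V with
    | zero => simp
    | add x y hx hy => simp only [map_add, hx, hy]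
    | tmul m n => simp [mul_comm]
  rw [map_sub, key, key, h, sub_self]

end Separation

/-! ### Evaluation at matrices indexed by arbitrary finite types -/

section Evaluation

variable {F : Type*} [Field F]

/-- The value of `φ ∈ C(q)` at a square matrix indexed by an arbitrary finite type. -/
def ev {ι : Type*} [Fintype ι] (x : Matrix ι ι F) : CSpace F →ₗ[ℂ] ℂ where
  toFun φ := (φ (Fintype.card ι)).1 (Matrix.reindex (Fintype.equivFin ι) (Fintype.equivFin ι) x)
  map_add' _ _ := rfl
  map_smul' _ _ := rfl

/-- The permutation matrix of `e`, as an invertible matrix. -/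
def permGL {ι : Type*} [Fintype ι] [DecidableEq ι] (e : Equiv.Perm ι) : GL ι F :=
  have h : ∀ s : Equiv.Perm ι, (Equiv.toPEquiv s).toMatrix * (Equiv.toPEquiv s.symm).toMatrix
      = (1 : Matrix ι ι F) := fun s => by
    rw [← PEquiv.toMatrix_trans, ← Equiv.toPEquiv_trans]
    simp
  ⟨(Equiv.toPEquiv e.symm).toMatrix, (Equiv.toPEquiv e).toMatrix, h e.symm, h e⟩

theorem permGL_conj {ι : Type*} [Fintype ι] [DecidableEq ι] (e : Equiv.Perm ι)
    (x : Matrix ι ι F) : (permGL e).val * x * (permGL e)⁻¹.val = Matrix.reindex e e x := by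
  change (Equiv.toPEquiv e.symm).toMatrix * x * (Equiv.toPEquiv e).toMatrix = _
  rw [PEquiv.toMatrix_toPEquiv_mul, PEquiv.mul_toMatrix_toPEquiv]
  rfl

theorem inv_reindex {n : ℕ} (f : Inv F n) (e : Equiv.Perm (Fin n)) (x : gl F n) :
    f.1 (Matrix.reindex e e x) = f.1 x := by
  rw [← permGL_conj, f.2]

/-- Two enumerations of the index type differ by a permutation, that is, by conjugation with a
permutation matrix, which class functions ignore. This frees later computations from the chosen
enumeration and from casts between `Fin n`. -/
theorem ev_eq {ι : Type*} [Fintype ι] {n : ℕ} (e : ι ≃ Fin n) (x : Matrix ι ι F) (φ : CSpace F) :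
    ev x φ = (φ n).1 (Matrix.reindex e e x) := by
  obtain rfl : Fintype.card ι = n := by simpa using Fintype.card_congr e
  rw [← inv_reindex (φ _) (e.symm.trans (Fintype.equivFin ι)) (Matrix.reindex e e x)]
  refine congrArg (φ (Fintype.card ι)).1 ?_
  ext i j
  simp

theorem ev_gl {n : ℕ} (x : gl F n) (φ : CSpace F) : ev x φ = (φ n).1 x := by
  simpa using ev_eq (Equiv.refl _) x φ

theorem ev_reindex {ι κ : Type*} [Fintype ι] [Fintype κ] (e : ι ≃ κ) (x : Matrix ι ι F)
    (φ : CSpace F) : ev (Matrix.reindex e e x) φ = ev x φ := by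
  rw [ev_eq (Fintype.equivFin κ), ev_eq (e.trans (Fintype.equivFin κ)) x]
  rfl

theorem ev_lof {ι : Type*} [Fintype ι] {n : ℕ} (e : ι ≃ Fin n) (x : Matrix ι ι F) (f : Inv F n) :
    ev x (DirectSum.lof ℂ ℕ (fun n => Inv F n) n f) = f.1 (Matrix.reindex e e x) := by
  rw [ev_eq e, DirectSum.lof_apply]

theorem ev_lof_of_ne {ι : Type*} [Fintype ι] {n : ℕ} (h : Fintype.card ι ≠ n) (x : Matrix ι ι F)
    (f : Inv F n) : ev x (DirectSum.lof ℂ ℕ (fun n => Inv F n) n f) = 0 := by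
  rw [ev_eq (Fintype.equivFin ι), DirectSum.lof_eq_of, DirectSum.of_eq_of_ne _ _ _ h]
  rfl

theorem ev_conj {ι : Type*} [Fintype ι] [DecidableEq ι] (g : GL ι F) (x : Matrix ι ι F)
    (φ : CSpace F) : ev (g.val * x * g⁻¹.val) φ = ev x φ := by
  let e := Fintype.equivFin ι
  rw [ev_eq e, ev_eq e]
  rw [← (φ _).2 (Units.mapEquiv (Matrix.reindexRingEquiv F e).toMulEquiv g) (Matrix.reindex e e x)]
  refine congrArg (φ (Fintype.card ι)).1 ?_
  change Matrix.reindexRingEquiv F e (_ * _ * _) = Matrix.reindexRingEquiv F e _ *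
    Matrix.reindexRingEquiv F e _ * Matrix.reindexRingEquiv F e _
  rw [map_mul, map_mul]
  rfl

theorem ev_separating (φ : CSpace F) (h : ∀ p : Σ n, gl F n, ev p.2 φ = 0) : φ = 0 := by
  refine DFinsupp.ext fun n => Subtype.ext <| funext fun x => ?_
  have := h ⟨n, x⟩
  rw [ev_gl] at this
  exact this

/-- The value of a tensor in `C(q) ⊗ C(q)`, seen as a function of two matrices. -/
def ev₂ {ι κ : Type*} [Fintype ι] [Fintype κ] (x : Matrix ι ι F) (y : Matrix κ κ F) :
    CSpace F ⊗[ℂ] CSpace F →ₗ[ℂ] ℂ :=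
  LinearMap.mul' ℂ ℂ ∘ₗ TensorProduct.map (ev x) (ev y)

theorem ev₂_tmul {ι κ : Type*} [Fintype ι] [Fintype κ] (x : Matrix ι ι F) (y : Matrix κ κ F)
    (φ ψ : CSpace F) : ev₂ x y (φ ⊗ₜ ψ) = ev x φ * ev y ψ := rfl

theorem ev₂_ext {T T' : CSpace F ⊗[ℂ] CSpace F}
    (h : ∀ (i j : ℕ) (x : gl F i) (y : gl F j), ev₂ x y T = ev₂ x y T') : T = T' :=
  tensor_ext (fun p : Σ n, gl F n => ev p.2) (fun p : Σ n, gl F n => ev p.2)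
    ev_separating ev_separating fun p q => h _ _ p.2 q.2

/-- The value of a tensor in `C(q) ⊗ (C(q) ⊗ C(q))`, seen as a function of three matrices. -/
def ev₃ {ι κ μ : Type*} [Fintype ι] [Fintype κ] [Fintype μ] (x : Matrix ι ι F) (y : Matrix κ κ F)
    (z : Matrix μ μ F) : CSpace F ⊗[ℂ] (CSpace F ⊗[ℂ] CSpace F) →ₗ[ℂ] ℂ :=
  LinearMap.mul' ℂ ℂ ∘ₗ TensorProduct.map (ev x) (ev₂ y z)

theorem ev₃_tmul {ι κ μ : Type*} [Fintype ι] [Fintype κ] [Fintype μ] (x : Matrix ι ι F)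
    (y : Matrix κ κ F) (z : Matrix μ μ F) (φ : CSpace F) (T : CSpace F ⊗[ℂ] CSpace F) :
    ev₃ x y z (φ ⊗ₜ T) = ev x φ * ev₂ y z T := rfl

theorem ev₃_ext {T T' : CSpace F ⊗[ℂ] (CSpace F ⊗[ℂ] CSpace F)}
    (h : ∀ (i j k : ℕ) (x : gl F i) (y : gl F j) (z : gl F k), ev₃ x y z T = ev₃ x y z T') :
    T = T' :=
  tensor_ext (fun p : Σ n, gl F n => ev p.2)
    (fun p : (Σ n, gl F n) × (Σ n, gl F n) => ev₂ p.1.2 p.2.2)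
    ev_separating (fun T hT => ev₂_ext fun i j x y => by
      rw [map_zero]; exact hT (⟨i, x⟩, ⟨j, y⟩)) fun p q => h _ _ _ p.2 q.1.2 q.2.2

end Evaluation

/-! ### The coproduct as an average over block triangular matrices -/

section Restriction

variable {F : Type*} [Field F]

theorem ev₂_boxEquiv_symm [Fintype F] {ι κ : Type*} [Fintype ι] [Fintype κ] {k l : ℕ} (e : ι ≃ Fin k)
    (e' : κ ≃ Fin l) (x : Matrix ι ι F) (y : Matrix κ κ F) (f : InvLevi F k l) :
    ev₂ x y (TensorProduct.map (DirectSum.lof ℂ ℕ (fun n => Inv F n) k)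
      (DirectSum.lof ℂ ℕ (fun n => Inv F n) l) ((boxEquiv k l).symm f)) =
      f.1 (Matrix.reindex e e x, Matrix.reindex e' e' y) := by
  obtain ⟨t, rfl⟩ := (boxEquiv k l).surjective f
  rw [LinearEquiv.symm_apply_apply]
  induction t with
  | zero => rw [map_zero, map_zero, LinearEquiv.map_zero]; rfl
  | add s t hs ht => rw [map_add, map_add, hs, ht, LinearEquiv.map_add]; rfl
  | tmul g h =>
    rw [TensorProduct.map_tmul, ev₂_tmul, ev_lof e, ev_lof e']
    rfl

theorem ev₂_map_lof_of_ne {ι κ : Type*} [Fintype ι] [Fintype κ] {k l : ℕ}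
    (h : ¬ (Fintype.card ι = k ∧ Fintype.card κ = l))
    (x : Matrix ι ι F) (y : Matrix κ κ F) (t : Inv F k ⊗[ℂ] Inv F l) :
    ev₂ x y (TensorProduct.map (DirectSum.lof ℂ ℕ (fun n => Inv F n) k)
      (DirectSum.lof ℂ ℕ (fun n => Inv F n) l) t) = 0 := by
  induction t with
  | zero => simp
  | add s t hs ht => simp only [map_add, hs, ht, add_zero]
  | tmul g h' =>
    rw [TensorProduct.map_tmul, ev₂_tmul]
    by_cases hk : Fintype.card ι = k
    · rw [ev_lof_of_ne (fun hl => h ⟨hk, hl⟩), mul_zero]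
    · rw [ev_lof_of_ne hk, zero_mul]

variable [Fintype F]

omit [Field F] in
theorem natCard_matrix (ι κ : Type*) [Fintype ι] [Fintype κ] :
    Nat.card (Matrix ι κ F) = Fintype.card F ^ (Fintype.card ι * Fintype.card κ) := by
  change Nat.card (ι → κ → F) = _
  rw [Nat.card_fun, Nat.card_fun, ← pow_mul, mul_comm]
  simp only [Nat.card_eq_fintype_card]

/-- Only the summand whose bidegree is given by the sizes of `x` and `y` survives evaluation; in all
other degrees of `φ` both sides vanish. Arbitrary index types allow the formula to be iterated with
sums of types as indices. -/
theorem ev₂_comulMap {ι κ : Type*} [Fintype ι] [Fintype κ] [DecidableEq ι] [DecidableEq κ]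
    (x : Matrix ι ι F) (y : Matrix κ κ F) (φ : CSpace F) :
    ev₂ x y (comulMap F φ) = ((Fintype.card F : ℂ) ^ (Fintype.card ι * Fintype.card κ))⁻¹ *
      ∑ u : Matrix ι κ F, ev (Matrix.fromBlocks x u 0 y) φ := by
  suffices h : ev₂ x y ∘ₗ comulMap F =
      ((Fintype.card F : ℂ) ^ (Fintype.card ι * Fintype.card κ))⁻¹ •
      ∑ u : Matrix ι κ F, ev (Matrix.fromBlocks x u 0 y) by
    have := LinearMap.congr_fun h φ
    simpa using this
  refine DirectSum.linearMap_ext ℂ fun n => LinearMap.ext fun f => ?_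
  simp only [LinearMap.comp_apply, comulMap, DirectSum.toModule_lof, LinearMap.sum_apply,
    map_sum, LinearMap.smul_apply]
  by_cases hn : Fintype.card ι + Fintype.card κ = n
  · let e := Fintype.equivFin ι
    let e' := Fintype.equivFin κ
    rw [Finset.sum_eq_single ⟨(Fintype.card ι, Fintype.card κ), by simpa using hn⟩]
    · rw [LinearEquiv.coe_coe, ev₂_boxEquiv_symm e e']
      rw [smul_eq_mul]
      change _ * _ = _
      congr 1
      · rw [natCard_matrix]; simp
      · refine (Fintype.sum_equiv (Matrix.reindex e e') _ _ fun u => ?_).symm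
        rw [ev_lof ((Equiv.sumCongr e e').trans (split hn))]
        refine congrArg f.1 ?_
        ext i j
        obtain ⟨i, rfl⟩ := (split hn).surjective i
        obtain ⟨j, rfl⟩ := (split hn).surjective j
        rcases i with i | i <;> rcases j with j | j <;> simp [blockUpper]
    · rintro ⟨⟨i, j⟩, hij⟩ - hne
      refine ev₂_map_lof_of_ne ?_ x y _
      rintro ⟨rfl, rfl⟩
      exact hne rfl
    · simp
  · rw [Finset.sum_eq_zero, Finset.sum_eq_zero, smul_zero]
    · intro u _
      exact ev_lof_of_ne (by simpa using hn) _ _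
    · rintro ⟨⟨i, j⟩, hij⟩ -
      refine ev₂_map_lof_of_ne ?_ x y _
      rintro ⟨rfl, rfl⟩
      exact hn (by simpa using hij)

end Restriction

/-! ### Coassociativity and the counit -/

section Coalgebra

variable {F : Type*} [Field F] [Fintype F]

omit [Field F] in
/-- Sums over matrices with a decomposed row index. -/
theorem sum_matrix_rows {ι κ μ : Type*} [Fintype ι] [Fintype κ] [Fintype μ] [DecidableEq ι]
    [DecidableEq κ] [DecidableEq μ] {A : Type*} [AddCommMonoid A]
    (f : Matrix (ι ⊕ κ) μ F → A) :
    ∑ u, f u = ∑ u : Matrix ι μ F, ∑ v : Matrix κ μ F, f (Matrix.fromRows u v) := by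
  rw [← Fintype.sum_prod_type']
  let e : Matrix ι μ F × Matrix κ μ F ≃ Matrix (ι ⊕ κ) μ F :=
    ⟨fun p => Matrix.fromRows p.1 p.2, fun M => (M.toRows₁, M.toRows₂), fun p => by simp,
      fun M => by simp⟩
  exact (Equiv.sum_comp e f).symm

omit [Field F] in
/-- Sums over matrices with a decomposed column index. -/
theorem sum_matrix_cols {ι κ μ : Type*} [Fintype ι] [Fintype κ] [Fintype μ] [DecidableEq ι]
    [DecidableEq κ] [DecidableEq μ] {A : Type*} [AddCommMonoid A]
    (f : Matrix μ (ι ⊕ κ) F → A) :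
    ∑ u, f u = ∑ u : Matrix μ ι F, ∑ v : Matrix μ κ F, f (Matrix.fromCols u v) := by
  rw [← Fintype.sum_prod_type']
  let e : Matrix μ ι F × Matrix μ κ F ≃ Matrix μ (ι ⊕ κ) F :=
    ⟨fun p => Matrix.fromCols p.1 p.2, fun M => (M.toCols₁, M.toCols₂), fun p => by simp,
      fun M => by simp⟩
  exact (Equiv.sum_comp e f).symm

/-- At `(x, y, z)` both sides average `φ` over the block upper triangular matrices with these
diagonal blocks. The normalizing exponents agree because `ij + (i + j)k = jk + i(j + k)`, and the
matrices agree up to reassociating the index set. -/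
theorem comulMap_coassoc (φ : CSpace F) :
    TensorProduct.assoc ℂ _ _ _ ((comulMap F).rTensor _ (comulMap F φ)) =
      (comulMap F).lTensor _ (comulMap F φ) := by
  refine ev₃_ext fun i j k x y z => ?_
  have hl : ∀ T, ev₃ x y z ((comulMap F).lTensor _ T) =
      ((Fintype.card F : ℂ) ^ (j * k))⁻¹ *
        ∑ v : Matrix (Fin j) (Fin k) F, ev₂ x (Matrix.fromBlocks y v 0 z) T := by
    intro T
    induction T with
    | zero => simp
    | add s t hs ht => simp only [map_add, hs, ht, Finset.sum_add_distrib, mul_add]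
    | tmul a b =>
      rw [LinearMap.lTensor_tmul, ev₃_tmul, ev₂_comulMap]
      simp only [ev₂_tmul, ← Finset.mul_sum, Fintype.card_fin]
      ring
  have hr : ∀ T, ev₃ x y z (TensorProduct.assoc ℂ _ _ _ ((comulMap F).rTensor _ T)) =
      ((Fintype.card F : ℂ) ^ (i * j))⁻¹ *
        ∑ v : Matrix (Fin i) (Fin j) F, ev₂ (Matrix.fromBlocks x v 0 y) z T := by
    have h3 : ∀ (S : CSpace F ⊗[ℂ] CSpace F) (b : CSpace F),
        ev₃ x y z (TensorProduct.assoc ℂ _ _ _ (S ⊗ₜ b)) = ev₂ x y S * ev z b := by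
      intro S b
      induction S with
      | zero => simp
      | add s t hs ht => simp only [map_add, TensorProduct.add_tmul, hs, ht, add_mul]
      | tmul a a' =>
        rw [TensorProduct.assoc_tmul, ev₃_tmul, ev₂_tmul, ev₂_tmul, mul_assoc]
    intro T
    induction T with
    | zero => simp
    | add s t hs ht => simp only [map_add, hs, ht, Finset.sum_add_distrib, mul_add]
    | tmul a b =>
      rw [LinearMap.rTensor_tmul, h3, ev₂_comulMap]
      simp only [ev₂_tmul, ← Finset.sum_mul, Fintype.card_fin]
      ring
  rw [hl, hr]
  simp only [ev₂_comulMap, ← Finset.mul_sum, Fintype.card_fin, Fintype.card_sum]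
  rw [← mul_assoc, ← mul_assoc, ← mul_inv, ← mul_inv, ← pow_add, ← pow_add]
  congr 1
  · congr 2; ring
  simp only [sum_matrix_rows, sum_matrix_cols]
  rw [eq_comm, Finset.sum_comm]
  refine Finset.sum_congr rfl fun v _ => ?_
  rw [Finset.sum_comm]
  refine Finset.sum_congr rfl fun u _ => Finset.sum_congr rfl fun w _ => ?_
  have h : Matrix.reindex (Equiv.sumAssoc (Fin i) (Fin j) (Fin k))
      (Equiv.sumAssoc (Fin i) (Fin j) (Fin k))
      (Matrix.fromBlocks (Matrix.fromBlocks x v 0 y) (Matrix.fromRows u w) 0 z) =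
      Matrix.fromBlocks x (Matrix.fromCols v u) 0 (Matrix.fromBlocks y w 0 z) := by
    refine Matrix.ext fun a b => ?_
    rcases a with a | a | a <;> rcases b with b | b | b <;> rfl
  rw [← h, ev_reindex]

omit [Fintype F] in
theorem counit_eq_ev (φ : CSpace F) : counitMap F φ = ev (0 : gl F 0) φ := (ev_gl _ _).symm

theorem comulMap_rTensor_counit (φ : CSpace F) :
    (counitMap F).rTensor _ (comulMap F φ) = 1 ⊗ₜ φ := by
  apply (TensorProduct.lid ℂ (CSpace F)).injective
  rw [← sub_eq_zero]
  refine ev_separating _ fun p => ?_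
  obtain ⟨n, y⟩ := p
  have key : ∀ T : CSpace F ⊗[ℂ] CSpace F,
      ev y (TensorProduct.lid ℂ _ ((counitMap F).rTensor _ T)) = ev₂ (0 : gl F 0) y T := by
    intro T
    induction T with
    | zero => simp
    | add s t hs ht => simp only [map_add, hs, ht]
    | tmul a b => simp [ev₂_tmul, counit_eq_ev]
  rw [map_sub, key, ev₂_comulMap]
  simp only [Fintype.card_fin, zero_mul, pow_zero, inv_one, one_mul,
    TensorProduct.lid_tmul, one_smul]
  rw [Fintype.sum_subsingleton _ 0, sub_eq_zero, ← ev_reindex (Equiv.emptySum (Fin 0) (Fin n))]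
  congr 1

theorem comulMap_lTensor_counit (φ : CSpace F) :
    (counitMap F).lTensor _ (comulMap F φ) = φ ⊗ₜ 1 := by
  apply (TensorProduct.rid ℂ (CSpace F)).injective
  rw [← sub_eq_zero]
  refine ev_separating _ fun p => ?_
  obtain ⟨n, y⟩ := p
  have key : ∀ T : CSpace F ⊗[ℂ] CSpace F,
      ev y (TensorProduct.rid ℂ _ ((counitMap F).lTensor _ T)) = ev₂ y (0 : gl F 0) T := by
    intro T
    induction T with
    | zero => simp
    | add s t hs ht => simp only [map_add, hs, ht]
    | tmul a b => simp [ev₂_tmul, counit_eq_ev, mul_comm]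
  rw [map_sub, key, ev₂_comulMap]
  simp only [Fintype.card_fin, mul_zero, pow_zero, inv_one, one_mul,
    TensorProduct.rid_tmul, one_smul]
  rw [Fintype.sum_subsingleton _ 0, sub_eq_zero, ← ev_reindex (Equiv.sumEmpty (Fin n) (Fin 0))]
  congr 1

instance : Coalgebra ℂ (CSpace F) where
  comul := comulMap F
  counit := counitMap F
  coassoc := LinearMap.ext comulMap_coassoc
  rTensor_counit_comp_comul := LinearMap.ext comulMap_rTensor_counit
  lTensor_counit_comp_comul := LinearMap.ext comulMap_lTensor_counit

end Coalgebra

/-! ### Square matrices are similar to their transposes -/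

section Transpose

open Polynomial

variable {F : Type*} [Field F]

/-- On a cyclic torsion module over `F[X]` there is a linear functional whose kernel contains no
nonzero submodule. -/
theorem exists_functional_of_ne_zero {f : F[X]} (hf : f ≠ 0) :
    ∃ t : F[X] →ₗ[F] F, (∀ g, f ∣ g → t g = 0) ∧ ∀ g, (∀ h, t (g * h) = 0) → f ∣ g := by
  wlog hm : f.Monic generalizing f
  · have hu : IsUnit (C f.leadingCoeff⁻¹) :=
      isUnit_C.2 (inv_ne_zero (leadingCoeff_ne_zero.2 hf)).isUnit
    have ha : Associated (f * C f.leadingCoeff⁻¹) f := associated_mul_unit_left _ _ hu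
    obtain ⟨t, ht, ht'⟩ := this (ha.symm.ne_zero_iff.1 hf) (monic_mul_leadingCoeff_inv hf)
    exact ⟨t, fun g hg => ht g (ha.dvd_iff_dvd_left.2 hg), fun g hg =>
      ha.dvd_iff_dvd_left.1 (ht' g hg)⟩
  -- The functional is the coefficient of `X ^ (deg f - 1)` in the remainder modulo `f`. For `f = 1`
  -- the truncated subtraction is harmless, since all remainders vanish.
  refine ⟨lcoeff F (f.natDegree - 1) ∘ₗ modByMonicHom f, fun g hg => ?_, fun g hg => ?_⟩
  · rw [LinearMap.comp_apply, modByMonicHom_apply, (modByMonic_eq_zero_iff_dvd hm).2 hg, map_zero]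
  · rw [← modByMonic_eq_zero_iff_dvd hm]
    by_contra hr
    have hlt : (g %ₘ f).natDegree < f.natDegree := by
      refine natDegree_lt_natDegree hr (degree_modByMonic_lt g hm)
    -- This power of `X` lifts a nonzero remainder to degree exactly `deg f - 1`, so no further
    -- reduction takes place and the functional returns the leading coefficient of the remainder.
    have h1 := hg (X ^ (f.natDegree - 1 - (g %ₘ f).natDegree))
    have h2 : (g * X ^ (f.natDegree - 1 - (g %ₘ f).natDegree)) %ₘ f =
        (g %ₘ f) * X ^ (f.natDegree - 1 - (g %ₘ f).natDegree) := by
      have h3 : g * X ^ (f.natDegree - 1 - (g %ₘ f).natDegree) =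
          (g %ₘ f) * X ^ (f.natDegree - 1 - (g %ₘ f).natDegree) +
            f * ((g /ₘ f) * X ^ (f.natDegree - 1 - (g %ₘ f).natDegree)) := by
        rw [← mul_assoc, ← add_mul, modByMonic_add_div g f]
      rw [h3, add_modByMonic, (modByMonic_eq_zero_iff_dvd hm).2 (dvd_mul_right _ _), add_zero]
      refine (modByMonic_eq_self_iff hm).2 (degree_lt_degree ?_)
      rw [natDegree_mul_X_pow _ hr]
      omega
    rw [LinearMap.comp_apply, modByMonicHom_apply, h2, lcoeff_apply] at h1
    rw [show f.natDegree - 1 = (g %ₘ f).natDegree + (f.natDegree - 1 - (g %ₘ f).natDegree) by omega,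
      coeff_mul_X_pow', if_pos (by omega)] at h1
    rw [show (g %ₘ f).natDegree + (f.natDegree - 1 - (g %ₘ f).natDegree) -
      ((g %ₘ f).natDegree + (f.natDegree - 1 - (g %ₘ f).natDegree) - (g %ₘ f).natDegree) =
      (g %ₘ f).natDegree by omega] at h1
    exact hr (leadingCoeff_eq_zero.1 h1)

/-- A finitely generated torsion module over `F[X]` carries a nondegenerate bilinear form over `F`
for which multiplication by `X` is self-adjoint. -/
theorem exists_form {M : Type*} [AddCommGroup M] [Module F[X] M] [Module F M]
    [IsScalarTower F F[X] M] [Module.Finite F[X] M] (hM : Module.IsTorsion F[X] M) :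
    ∃ B : M →ₗ[F] M →ₗ[F] F, (∀ m n, B ((X : F[X]) • m) n = B m ((X : F[X]) • n)) ∧
      ∀ m, (∀ n, B m n = 0) → m = 0 := by
  classical
  obtain ⟨ι, _, p, hp, e, ⟨φ⟩⟩ := Module.equiv_directSum_of_isTorsion hM
  have hne : ∀ i, p i ^ e i ≠ 0 := fun i => pow_ne_zero _ (hp i).ne_zero
  choose t ht ht' using fun i => exists_functional_of_ne_zero (hne i)
  let q : ∀ i, M →ₗ[F[X]] F[X] ⧸ Ideal.span {p i ^ e i} := fun i =>
    DirectSum.component F[X] ι (fun i => F[X] ⧸ (F[X] ∙ p i ^ e i)) i ∘ₗ φ.toLinearMap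
  have hq : ∀ m, (∀ i, q i m = 0) → m = 0 := fun m hm =>
    φ.map_eq_zero_iff.1 (DFinsupp.ext hm)
  have hq' : ∀ i a, ∃ n, q i n = a ∧ ∀ j, j ≠ i → q j n = 0 := by
    intro i a
    refine ⟨φ.symm (DirectSum.lof F[X] ι (fun i => F[X] ⧸ (F[X] ∙ p i ^ e i)) i a), ?_, ?_⟩
    · simp only [q, LinearMap.comp_apply, LinearEquiv.coe_coe, LinearEquiv.apply_symm_apply]
      exact DirectSum.component.lof_self _ _ _
    · intro j hj
      simp only [q, LinearMap.comp_apply, LinearEquiv.coe_coe, LinearEquiv.apply_symm_apply]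
      rw [DirectSum.component.of, dif_neg hj.symm]
  let s : ∀ i, (F[X] ⧸ Ideal.span {p i ^ e i}) →+ F := fun i =>
    QuotientAddGroup.lift (Ideal.span {p i ^ e i}).toAddSubgroup (t i).toAddMonoidHom
      (fun g hg => ht i g (Ideal.mem_span_singleton.1 hg))
  have hs : ∀ i g, s i (Ideal.Quotient.mk _ g) = t i g := fun i g => rfl
  have hs' : ∀ i (c : F) a, s i (algebraMap F F[X] c • a) = c * s i a := by
    intro i c a
    obtain ⟨g, rfl⟩ := Ideal.Quotient.mk_surjective a
    rw [hs, ← smul_eq_mul, ← (t i).map_smul, ← hs, ← algebraMap_smul F[X] c g]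
    rfl
  -- On each cyclic summand the form is `(a, b) ↦ t(ab)`. It depends only on the product, whence
  -- self-adjointness of `X`; its radical is an ideal on which `t` vanishes, hence zero.
  refine ⟨LinearMap.mk₂ F (fun m n => ∑ i, s i (q i m * q i n)) ?_ ?_ ?_ ?_, ?_, ?_⟩
  · intro m m' n
    simp only [map_add, add_mul, Finset.sum_add_distrib]
  · intro c m n
    rw [← algebraMap_smul F[X] c m]
    simp only [map_smul, smul_mul_assoc, hs', Finset.mul_sum, smul_eq_mul]
  · intro m n n'
    simp only [map_add, mul_add, Finset.sum_add_distrib]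
  · intro c m n
    rw [← algebraMap_smul F[X] c n]
    simp only [map_smul, mul_smul_comm, hs', Finset.mul_sum, smul_eq_mul]
  · intro m n
    simp only [LinearMap.mk₂_apply, map_smul, smul_mul_assoc, mul_smul_comm]
  · intro m hm
    refine hq m fun i => ?_
    obtain ⟨g, hg⟩ := Ideal.Quotient.mk_surjective (q i m)
    rw [← hg, Ideal.Quotient.eq_zero_iff_mem, Ideal.mem_span_singleton]
    refine ht' i g fun h => ?_
    obtain ⟨n, hn, hn'⟩ := hq' i (Ideal.Quotient.mk _ h)
    have := hm n
    rw [LinearMap.mk₂_apply, Finset.sum_eq_single i, hn, ← hg, ← map_mul, hs] at this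
    · exact this
    · intro j _ hj
      rw [hn' j hj, mul_zero, map_zero]
    · simp

/-- Every square matrix over a field is similar to its transpose. -/
theorem exists_conj_eq_transpose {ι : Type*} [Fintype ι] [DecidableEq ι] (x : Matrix ι ι F) :
    ∃ g : GL ι F, g.val * x * g⁻¹.val = x.transpose := by
  let a : (ι → F) →ₗ[F] (ι → F) := x.toLin'
  have hfin : Module.Finite F[X] (Module.AEval' a) := inferInstance
  have htor : Module.IsTorsion F[X] (Module.AEval' a) :=
    Module.AEval.isTorsion_of_finiteDimensional F (ι → F) a
  obtain ⟨B, hB, hB'⟩ := exists_form (F := F) htor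
  let o := Module.AEval'.of a
  let B' : LinearMap.BilinForm F (ι → F) := B.compl₁₂ o.toLinearMap o.toLinearMap
  -- Self-adjointness of `x` for the form says `xᵀ S = S x` for the Gram matrix `S`, and
  -- nondegeneracy makes `S` invertible, so `S` is the required conjugating matrix.
  let S : Matrix ι ι F := LinearMap.BilinForm.toMatrix' B'
  have hS : x.transpose * S = S * x := by
    have h1 := LinearMap.BilinForm.toMatrix'_compLeft B' a
    have h2 := LinearMap.BilinForm.toMatrix'_compRight B' a
    have h3 : B'.compLeft a = B'.compRight a := by
      refine LinearMap.ext fun v => LinearMap.ext fun w => ?_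
      change B (o (a v)) (o w) = B (o v) (o (a w))
      rw [← Module.AEval'.X_smul_of, hB, Module.AEval'.X_smul_of]
    rw [LinearMap.toMatrix'_toLin'] at h1 h2
    rw [← h1, h3, h2]
  have hB'' : LinearMap.SeparatingLeft B' := fun v hv => o.map_eq_zero_iff.1 <|
    hB' _ fun n => by simpa [B'] using hv (o.symm n)
  have hdet : S.det ≠ 0 :=
    Matrix.separatingLeft_iff_det_ne_zero.1
      (LinearMap.BilinForm.separatingLeft_toMatrix'_iff.2 hB'')
  refine ⟨Matrix.GeneralLinearGroup.mkOfDetNeZero S hdet, ?_⟩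
  rw [Units.mul_inv_eq_iff_eq_mul]
  exact hS.symm

theorem ev_transpose {ι : Type*} [Fintype ι] (x : Matrix ι ι F) (φ : CSpace F) :
    ev x.transpose φ = ev x φ := by
  classical
  obtain ⟨g, hg⟩ := exists_conj_eq_transpose x
  rw [← hg, ev_conj]

theorem ev₂_transpose {ι κ : Type*} [Fintype ι] [Fintype κ] (x : Matrix ι ι F) (y : Matrix κ κ F)
    (T : CSpace F ⊗[ℂ] CSpace F) : ev₂ x.transpose y.transpose T = ev₂ x y T := by
  induction T with
  | zero => simp
  | add s t hs ht => simp only [map_add, hs, ht]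
  | tmul a b => rw [ev₂_tmul, ev₂_tmul, ev_transpose, ev_transpose]

/-- Transposing a block upper triangular matrix and swapping the two index blocks gives again a
block upper triangular matrix, with the transposed diagonal blocks in the opposite order. Since `φ`
does not see transposes, neither does the average. -/
theorem comulMap_comm [Fintype F] (φ : CSpace F) :
    TensorProduct.comm ℂ _ _ (comulMap F φ) = comulMap F φ := by
  refine ev₂_ext fun i j x y => ?_
  have key : ∀ T : CSpace F ⊗[ℂ] CSpace F,
      ev₂ x y (TensorProduct.comm ℂ _ _ T) = ev₂ y x T := by
    intro T
    induction T with
    | zero => simp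
    | add s t hs ht => simp only [map_add, hs, ht]
    | tmul a b => rw [TensorProduct.comm_tmul, ev₂_tmul, ev₂_tmul, mul_comm]
  rw [key, ← ev₂_transpose, ev₂_comulMap, ev₂_comulMap, mul_comm (Fintype.card (Fin j))]
  congr 1
  refine Fintype.sum_equiv (Matrix.transposeAddEquiv (Fin j) (Fin i) F).toEquiv _ _ fun u => ?_
  rw [← ev_transpose, Matrix.fromBlocks_transpose, ← ev_reindex (Equiv.sumComm (Fin j) (Fin i))]
  have h : Matrix.reindex (Equiv.sumComm (Fin j) (Fin i)) (Equiv.sumComm (Fin j) (Fin i))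
      (Matrix.fromBlocks y.transpose.transpose (Matrix.transpose 0) u.transpose
        x.transpose.transpose) = Matrix.fromBlocks x u.transpose 0 y := by
    refine Matrix.ext fun a b => ?_
    rcases a with a | a <;> rcases b with b | b <;> rfl
  rw [h]
  rfl

instance [Fintype F] : Coalgebra.IsCocomm ℂ (CSpace F) where
  comm_comp_comul := LinearMap.ext comulMap_comm

end Transpose

/-! ### Sums over block matrices -/

section Blocks

variable {F : Type*} [Field F] [Fintype F]

/-- The matrices with vanishing lower left block, as a sum over the other three blocks. -/
theorem sum_toBlocks₂₁_eq_zero {ι κ ι' κ' : Type*} [Fintype ι] [Fintype κ] [Fintype ι']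
    [Fintype κ'] [DecidableEq ι] [DecidableEq κ] [DecidableEq ι'] [DecidableEq κ']
    [DecidableEq F] {A : Type*} [AddCommMonoid A] (f : Matrix (ι ⊕ κ) (ι' ⊕ κ') F → A) :
    ∑ z, (if z.toBlocks₂₁ = 0 then f z else 0) =
      ∑ a : Matrix ι ι' F, ∑ b : Matrix ι κ' F, ∑ d : Matrix κ κ' F,
        f (Matrix.fromBlocks a b 0 d) := by
  rw [sum_matrix_rows]
  simp only [sum_matrix_cols]
  refine Finset.sum_congr rfl fun a _ => Finset.sum_congr rfl fun b _ => ?_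
  rw [Finset.sum_eq_single 0]
  · refine Finset.sum_congr rfl fun d _ => ?_
    have h : Matrix.fromRows (Matrix.fromCols a b) (Matrix.fromCols 0 d) =
        Matrix.fromBlocks a b 0 d := Matrix.fromRows_fromCols_eq_fromBlocks _ _ _ _
    rw [h, Matrix.toBlocks_fromBlocks₂₁, if_pos rfl]
  · intro c _ hc
    refine Finset.sum_eq_zero fun d _ => if_neg ?_
    rw [Matrix.fromRows_fromCols_eq_fromBlocks, Matrix.toBlocks_fromBlocks₂₁]
    exact hc
  · simp

theorem isUnit_fromBlocks_zero₂₁ {ι κ : Type*} [Fintype ι] [Fintype κ] [DecidableEq ι]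
    [DecidableEq κ] (x : Matrix ι ι F) (u : Matrix ι κ F) (y : Matrix κ κ F) :
    IsUnit (Matrix.fromBlocks x u 0 y) ↔ IsUnit x ∧ IsUnit y := by
  simp only [Matrix.isUnit_iff_isUnit_det, Matrix.det_fromBlocks_zero₂₁, IsUnit.mul_iff]

open scoped Classical in
theorem sum_GL {ι : Type*} [Fintype ι] [DecidableEq ι] [DecidableEq F] {A : Type*}
    [AddCommMonoid A] (f : Matrix ι ι F → A) :
    ∑ g : GL ι F, f g.val = ∑ z : Matrix ι ι F, if IsUnit z then f z else 0 := by
  rw [← Finset.sum_filter]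
  refine Finset.sum_bij (fun g _ => g.val) (fun g _ => ?_) (fun g _ g' _ h => Units.ext h)
    (fun z hz => ?_) (fun g _ => rfl)
  · simp
  · obtain ⟨g, rfl⟩ := (Finset.mem_filter.1 hz).2
    exact ⟨g, Finset.mem_univ _, rfl⟩

open scoped Classical in
theorem card_GL {ι : Type*} [Fintype ι] [DecidableEq ι] [DecidableEq F] :
    (Fintype.card (GL ι F) : ℂ) = ∑ z : Matrix ι ι F, if IsUnit z then 1 else 0 := by
  rw [← sum_GL fun _ => (1 : ℂ)]
  simp

theorem card_GL_ne_zero (ι : Type*) [Fintype ι] [DecidableEq ι] [DecidableEq F] :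
    (Fintype.card (GL ι F) : ℂ) ≠ 0 := Nat.cast_ne_zero.2 Fintype.card_ne_zero

omit [Field F] in
theorem card_matrix (ι κ : Type*) [Fintype ι] [Fintype κ] [DecidableEq ι] [DecidableEq κ] :
    (Fintype.card (Matrix ι κ F) : ℂ) =
      (Fintype.card F : ℂ) ^ (Fintype.card ι * Fintype.card κ) := by
  rw [← Nat.card_eq_fintype_card, natCard_matrix]
  push_cast
  rfl

variable [DecidableEq F]

omit [Fintype F] [DecidableEq F] in
theorem blocks_blockUpper {k l n : ℕ} (h : k + l = n) (x : gl F k) (u : Matrix (Fin k) (Fin l) F)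
    (y : gl F l) : blocks h (blockUpper h x u y) = Matrix.fromBlocks x u 0 y := by
  ext i j
  simp [blocks, blockUpper]

omit [Fintype F] [DecidableEq F] in
theorem proj_blockUpper {k l n : ℕ} (h : k + l = n) (x : gl F k) (u : Matrix (Fin k) (Fin l) F)
    (y : gl F l) : proj h (blockUpper h x u y) = (x, y) := by
  rw [proj, blocks_blockUpper]
  rfl

theorem sum_inPar {k l n : ℕ} (h : k + l = n) {A : Type*} [AddCommMonoid A] (f : gl F n → A) :
    ∑ z, (if InPar h z then f z else 0) =
      ∑ x : gl F k, ∑ u : Matrix (Fin k) (Fin l) F, ∑ y : gl F l, f (blockUpper h x u y) := by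
  refine Eq.trans ?_ (sum_toBlocks₂₁_eq_zero fun z => f (Matrix.reindex (split h) (split h) z))
  rw [← Equiv.sum_comp (Matrix.reindex (split h) (split h))]
  refine Finset.sum_congr rfl fun z _ => if_congr ?_ rfl rfl
  have : blocks h (Matrix.reindex (split h) (split h) z) = z := by
    ext i j
    simp [blocks]
  rw [InPar, this]

omit [DecidableEq F] in
theorem isUnit_blockUpper {k l n : ℕ} (h : k + l = n) (x : gl F k) (u : Matrix (Fin k) (Fin l) F)
    (y : gl F l) : IsUnit (blockUpper h x u y) ↔ IsUnit x ∧ IsUnit y := by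
  rw [← isUnit_fromBlocks_zero₂₁ x u y]
  exact MulEquiv.isUnit_map (Matrix.reindexRingEquiv F (split h))

theorem card_parabolic {k l n : ℕ} (h : k + l = n) :
    (Nat.card {g : GL (Fin n) F // InPar h g.val} : ℂ) =
      Fintype.card (GL (Fin k) F) * Fintype.card (GL (Fin l) F) *
        (Fintype.card F : ℂ) ^ (k * l) := by
  classical
  have h1 : (Nat.card {g : GL (Fin n) F // InPar h g.val} : ℂ) =
      ∑ z : gl F n, if IsUnit z then (if InPar h z then 1 else 0) else 0 := by
    rw [← sum_GL fun z => if InPar h z then (1 : ℂ) else 0, Nat.card_eq_fintype_card,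
      Fintype.card_subtype]
    simp
  have h2 : (Nat.card {g : GL (Fin n) F // InPar h g.val} : ℂ) =
      ∑ z : gl F n, if InPar h z then (if IsUnit z then 1 else 0) else 0 := by
    rw [h1]
    refine Finset.sum_congr rfl fun z _ => ?_
    split_ifs <;> rfl
  rw [h2, sum_inPar]
  simp only [isUnit_blockUpper]
  have h3 : ∀ (x : gl F k) (y : gl F l), (if IsUnit x ∧ IsUnit y then (1 : ℂ) else 0) =
      (if IsUnit x then 1 else 0) * (if IsUnit y then 1 else 0) := by
    intro x y
    by_cases hx : IsUnit x <;> simp [hx]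
  simp only [h3, ← Finset.mul_sum, ← Finset.sum_mul, ← card_GL, Finset.sum_const, nsmul_eq_mul,
    Finset.card_univ, card_matrix, Fintype.card_fin]
  ring

end Blocks

/-! ### The pairing on `C(q)` -/

section Pairing

variable {F : Type*} [Field F] [Fintype F] [DecidableEq F]

omit [Fintype F] [DecidableEq F] in
theorem CSpace.induction {p : CSpace F → Prop} (zero : p 0) (add : ∀ a b, p a → p b → p (a + b))
    (lof : ∀ n f, p (DirectSum.lof ℂ ℕ (fun n => Inv F n) n f)) (a : CSpace F) : p a :=
  DirectSum.induction_on a zero lof add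

variable (F) in
/-- The pairing `⟨f, g⟩ = |GLₙ(F)|⁻¹ ∑ₓ f(x) g(x)` on `C(𝔤𝔩ₙ)`. -/
def pairingInv (n : ℕ) : Inv F n →ₗ[ℂ] Inv F n →ₗ[ℂ] ℂ :=
  LinearMap.mk₂ ℂ (fun f g => (Fintype.card (GL (Fin n) F) : ℂ)⁻¹ * ∑ x, f.1 x * g.1 x)
    (fun f f' g => by
      rw [← mul_add, ← Finset.sum_add_distrib]
      simp only [← add_mul]
      rfl)
    (fun c f g => by
      rw [smul_eq_mul, mul_left_comm, Finset.mul_sum _ _ c]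
      simp only [← mul_assoc c]
      rfl)
    (fun f g g' => by
      rw [← mul_add, ← Finset.sum_add_distrib]
      simp only [← mul_add]
      rfl)
    (fun c f g => by
      rw [smul_eq_mul, mul_left_comm, Finset.mul_sum _ _ c]
      simp only [mul_left_comm c]
      rfl)

variable (F) in
/-- The pairing on `C(q)` for which the homogeneous components are orthogonal. -/
def pairing : CSpace F →ₗ[ℂ] CSpace F →ₗ[ℂ] ℂ :=
  DirectSum.toModule ℂ ℕ _ fun n =>
    (pairingInv F n).compl₂ (DirectSum.component ℂ ℕ (fun n => Inv F n) n)

theorem pairing_lof {n : ℕ} (f : Inv F n) (φ : CSpace F) :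
    pairing F (DirectSum.lof ℂ ℕ (fun n => Inv F n) n f) φ =
      (Fintype.card (GL (Fin n) F) : ℂ)⁻¹ * ∑ x, f.1 x * ev x φ := by
  rw [pairing, DirectSum.toModule_lof]
  simp only [ev_gl]
  rfl

theorem pairing_lof_lof_of_ne {m n : ℕ} (h : m ≠ n) (f : Inv F m) (g : Inv F n) :
    pairing F (DirectSum.lof ℂ ℕ (fun n => Inv F n) m f)
      (DirectSum.lof ℂ ℕ (fun n => Inv F n) n g) = 0 := by
  rw [pairing_lof, Finset.sum_eq_zero, mul_zero]
  intro x _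
  rw [ev_lof_of_ne (by simpa using h), mul_zero]

theorem pairing_comm (φ ψ : CSpace F) : pairing F φ ψ = pairing F ψ φ := by
  induction φ using CSpace.induction with
  | zero => simp
  | add a b ha hb => simp only [map_add, LinearMap.add_apply, ha, hb]
  | lof m f =>
    induction ψ using CSpace.induction with
    | zero => simp
    | add a b ha hb => simp only [map_add, LinearMap.add_apply, ha, hb]
    | lof n g =>
      by_cases h : m = n
      · subst h
        rw [pairing_lof, pairing_lof]
        simp only [ev_gl, DirectSum.lof_apply, mul_comm]
      · rw [pairing_lof_lof_of_ne h, pairing_lof_lof_of_ne (Ne.symm h)]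

theorem pairing_separating (φ : CSpace F)
    (h : ∀ p : Σ n, Inv F n,
      pairing F (DirectSum.lof ℂ ℕ (fun n => Inv F n) p.1 p.2) φ = 0) : φ = 0 := by
  refine ev_separating φ fun p => ?_
  obtain ⟨n, x⟩ := p
  -- The pairing is bilinear, not Hermitian, so the degree `n` part is tested against its own
  -- complex conjugate, which yields `∑ |φ(x)|²`.
  have h1 := h ⟨n, ⟨fun x => starRingEnd ℂ ((φ n).1 x), fun g x => congrArg _ ((φ n).2 g x)⟩⟩
  rw [pairing_lof, mul_eq_zero, inv_eq_zero, or_iff_right (card_GL_ne_zero _)] at h1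
  simp only [ev_gl, ← Complex.normSq_eq_conj_mul_self] at h1
  rw [← Complex.ofReal_sum, Complex.ofReal_eq_zero,
    Finset.sum_eq_zero_iff_of_nonneg fun x _ => Complex.normSq_nonneg _] at h1
  rw [ev_gl]
  exact Complex.normSq_eq_zero.1 (h1 x (Finset.mem_univ _))

/-- The functional `φ ⊗ ψ ↦ ⟨a, φ⟩ ⟨b, ψ⟩` on `C(q) ⊗ C(q)`. -/
def pairing₂ (a b : CSpace F) : CSpace F ⊗[ℂ] CSpace F →ₗ[ℂ] ℂ :=
  LinearMap.mul' ℂ ℂ ∘ₗ TensorProduct.map (pairing F a) (pairing F b)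

theorem pairing₂_tmul (a b φ ψ : CSpace F) :
    pairing₂ a b (φ ⊗ₜ ψ) = pairing F a φ * pairing F b ψ := rfl

theorem pairing₂_lof {k l : ℕ} (f : Inv F k) (g : Inv F l) (T : CSpace F ⊗[ℂ] CSpace F) :
    pairing₂ (DirectSum.lof ℂ ℕ (fun n => Inv F n) k f)
      (DirectSum.lof ℂ ℕ (fun n => Inv F n) l g) T =
      (Fintype.card (GL (Fin k) F) : ℂ)⁻¹ * (Fintype.card (GL (Fin l) F) : ℂ)⁻¹ *
        ∑ x, ∑ y, f.1 x * g.1 y * ev₂ x y T := by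
  induction T with
  | zero => simp
  | add s t hs ht => simp only [map_add, hs, ht, mul_add, Finset.sum_add_distrib]
  | tmul a b =>
    rw [pairing₂_tmul, pairing_lof, pairing_lof, mul_mul_mul_comm, Finset.sum_mul_sum]
    simp only [ev₂_tmul]
    congr 1
    refine Finset.sum_congr rfl fun x _ => Finset.sum_congr rfl fun y _ => ?_
    ring

theorem pairing₂_ext {T T' : CSpace F ⊗[ℂ] CSpace F}
    (h : ∀ (k l : ℕ) (f : Inv F k) (g : Inv F l),
      pairing₂ (DirectSum.lof ℂ ℕ (fun n => Inv F n) k f)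
        (DirectSum.lof ℂ ℕ (fun n => Inv F n) l g) T =
      pairing₂ (DirectSum.lof ℂ ℕ (fun n => Inv F n) k f)
        (DirectSum.lof ℂ ℕ (fun n => Inv F n) l g) T') : T = T' :=
  tensor_ext (fun p : Σ n, Inv F n => pairing F (DirectSum.lof ℂ ℕ (fun n => Inv F n) p.1 p.2))
    (fun p : Σ n, Inv F n => pairing F (DirectSum.lof ℂ ℕ (fun n => Inv F n) p.1 p.2))
    pairing_separating pairing_separating fun p q => h _ _ p.2 q.2

theorem mulMap_lof {k l : ℕ} (f : Inv F k) (g : Inv F l) :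
    mulMap F (DirectSum.lof ℂ ℕ (fun n => Inv F n) k f ⊗ₜ
      DirectSum.lof ℂ ℕ (fun n => Inv F n) l g) =
      DirectSum.lof ℂ ℕ (fun n => Inv F n) (k + l) (hcInd rfl (box k l f g)) := by
  simp only [mulMap, TensorProduct.lift.tmul, DirectSum.toModule_lof, LinearMap.flip_apply,
    TensorProduct.curry_apply, LinearMap.comp_apply]
  rfl

/-- After exchanging the sums, the substitution `z = g x g⁻¹` and the invariance of `φ` make the
inner sum independent of `g`. The `|GLₙ|` equal terms cancel the normalization of the pairing. This
is Frobenius reciprocity before the restriction is normalized. -/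
theorem sum_hcIndFun_mul {k l n : ℕ} (h : k + l = n) (f : gl F k × gl F l → ℂ) (φ : Inv F n) :
    (Fintype.card (GL (Fin n) F) : ℂ)⁻¹ * ∑ x, hcIndFun h f x * φ.1 x =
      (Fintype.card (GL (Fin k) F) * Fintype.card (GL (Fin l) F) *
        (Fintype.card F : ℂ) ^ (k * l))⁻¹ *
        ∑ x, ∑ u, ∑ y, f (x, y) * φ.1 (blockUpper h x u y) := by
  have h1 : ∀ g : GL (Fin n) F,
      ∑ x, (if InPar h (g.val * x * g⁻¹.val) then f (proj h (g.val * x * g⁻¹.val)) else 0) * φ.1 x =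
        ∑ x, ∑ u, ∑ y, f (x, y) * φ.1 (blockUpper h x u y) := by
    intro g
    have h2 := sum_inPar h (fun z => f (proj h z) * φ.1 z)
    simp only [proj_blockUpper] at h2
    rw [← h2]
    refine Fintype.sum_equiv ⟨fun z => g.val * z * g⁻¹.val, fun z => g⁻¹.val * z * g.val,
      fun z => by simp [mul_assoc], fun z => by simp [mul_assoc]⟩ _ _ fun z => ?_
    rw [Equiv.coe_fn_mk, φ.2, ite_mul, zero_mul]
  simp only [hcIndFun, card_parabolic, mul_assoc (_⁻¹), ← Finset.mul_sum]
  simp only [Finset.sum_mul]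
  rw [Finset.sum_comm, Finset.sum_congr rfl fun g _ => h1 g, Finset.sum_const, Finset.card_univ,
    nsmul_eq_mul, mul_left_comm, inv_mul_cancel_left₀ (card_GL_ne_zero _)]

omit [Fintype F] [DecidableEq F] in
theorem ev_blockUpper {k l n : ℕ} (h : k + l = n) (x : gl F k) (u : Matrix (Fin k) (Fin l) F)
    (y : gl F l) (φ : CSpace F) :
    ev (blockUpper h x u y) φ = ev (Matrix.fromBlocks x u 0 y) φ :=
  ev_reindex _ _ _

/-- The product and the coproduct are adjoint with respect to the pairing. -/
theorem pairing_mulMap (a b c : CSpace F) :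
    pairing F (mulMap F (a ⊗ₜ b)) c = pairing₂ a b (comulMap F c) := by
  induction a using CSpace.induction with
  | zero => simp [pairing₂]
  | add a a' ha ha' =>
    rw [TensorProduct.add_tmul, map_add, map_add, LinearMap.add_apply, ha, ha']
    simp only [pairing₂, map_add, TensorProduct.map_add_left, LinearMap.comp_apply,
      LinearMap.add_apply]
  | lof k f =>
    induction b using CSpace.induction with
    | zero => simp [pairing₂]
    | add a a' ha ha' =>
      rw [TensorProduct.tmul_add, map_add, map_add, LinearMap.add_apply, ha, ha']
      simp only [pairing₂, map_add, TensorProduct.map_add_right, LinearMap.comp_apply,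
        LinearMap.add_apply]
    | lof l g =>
      rw [mulMap_lof, pairing_lof, pairing₂_lof]
      simp only [ev₂_comulMap, ev_gl]
      have h1 := sum_hcIndFun_mul (rfl : k + l = k + l) (box k l f g).1 (c (k + l))
      simp only [← ev_gl, ev_blockUpper] at h1
      simp only [← ev_gl]
      refine h1.trans ?_
      simp only [Finset.mul_sum, box_apply, Fintype.card_fin]
      refine Finset.sum_congr rfl fun x _ => ?_
      rw [Finset.sum_comm]
      refine Finset.sum_congr rfl fun y _ => Finset.sum_congr rfl fun u _ => ?_
      rw [mul_inv, mul_inv]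
      ring

end Pairing

/-! ### Sums over double cosets -/

section DoubleCosets

variable {G : Type*} [Group G]

/-- Starting from one factorization `g = p₀' w p₀`, all others are `(p₀' (w s w⁻¹)⁻¹, s p₀)` with
`s` in the intersection of `P` and `w⁻¹ P' w`. -/
theorem card_doubleCoset_fiber (P' P : Subgroup G) (w g p₀' p₀ : G) (hp₀' : p₀' ∈ P')
    (hp₀ : p₀ ∈ P) (hg : p₀' * w * p₀ = g) :
    Nat.card {p : P' × P // p.1.1 * w * p.2.1 = g} =
      Nat.card {s : G // s ∈ P ∧ w * s * w⁻¹ ∈ P'} := by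
  refine Nat.card_congr ⟨fun p => ⟨p.1.2.1 * p₀⁻¹, P.mul_mem p.1.2.2 (P.inv_mem hp₀), ?_⟩,
    fun s => ⟨(⟨p₀' * (w * s.1 * w⁻¹)⁻¹, P'.mul_mem hp₀' (P'.inv_mem s.2.2)⟩,
      ⟨s.1 * p₀, P.mul_mem s.2.1 hp₀⟩), ?_⟩, ?_, ?_⟩
  · have h : w * (p.1.2.1 * p₀⁻¹) * w⁻¹ = p.1.1.1⁻¹ * p₀' := by
      have h1 : w * p.1.2.1 = p.1.1.1⁻¹ * g := by
        refine eq_inv_mul_of_mul_eq ?_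
        rw [← mul_assoc, p.2]
      have h2 : g * p₀⁻¹ * w⁻¹ = p₀' := by
        rw [mul_inv_eq_iff_eq_mul, mul_inv_eq_iff_eq_mul, hg]
      rw [← mul_assoc, h1, mul_assoc _ g, mul_assoc _ (g * _), h2]
    rw [h]
    exact P'.mul_mem (P'.inv_mem p.1.1.2) hp₀'
  · rw [← hg]
    group
  · rintro ⟨⟨⟨p', hp'⟩, ⟨p, hp⟩⟩, h⟩
    dsimp only at h ⊢
    refine Subtype.ext (Prod.ext (Subtype.ext ?_) (Subtype.ext ?_))
    · have h1 : w * p = p'⁻¹ * g := by rw [← h]; group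
      dsimp only
      rw [← mul_assoc, h1, ← hg]
      group
    · simp
  · rintro ⟨s, hs⟩
    refine Subtype.ext ?_
    simp

/-- If the double cosets `P' w P` with `w` in a family of representatives partition `G`, then the
sum of a function invariant under `P'` and `P` is a weighted sum of its values at these `w`. -/
theorem sum_eq_sum_doubleCosets [Fintype G] (P' P : Subgroup G) {T : Type*} [Fintype T]
    (w : T → G) (hcover : ∀ g, ∃ t, ∃ p' ∈ P', ∃ p ∈ P, p' * w t * p = g)
    (hdisj : ∀ t t' p' p, p' ∈ P' → p ∈ P → p' * w t * p = w t' → t = t')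
    (Φ : G → ℂ) (hΦ : ∀ p' g p, p' ∈ P' → p ∈ P → Φ (p' * g * p) = Φ g) :
    ∑ g, Φ g = ∑ t, Nat.card P' * Nat.card P *
      (Nat.card {s : G // s ∈ P ∧ w t * s * (w t)⁻¹ ∈ P'} : ℂ)⁻¹ * Φ (w t) := by
  classical
  have hfib : ∀ t, ∑ g, (Nat.card {p : P' × P // p.1.1 * w t * p.2.1 = g} : ℂ) =
      Nat.card P' * Nat.card P := by
    intro t
    rw [← Nat.cast_sum, ← Nat.cast_mul, ← Nat.card_prod, ← Nat.card_sigma]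
    rw [Nat.card_congr (Equiv.sigmaFiberEquiv fun p : P' × P => p.1.1 * w t * p.2.1)]
  have hS : ∀ t, (Nat.card {s : G // s ∈ P ∧ w t * s * (w t)⁻¹ ∈ P'} : ℂ) ≠ 0 := by
    intro t
    rw [Nat.cast_ne_zero]
    have : Nonempty {s : G // s ∈ P ∧ w t * s * (w t)⁻¹ ∈ P'} :=
      ⟨1, P.one_mem, by simp⟩
    exact Nat.card_pos.ne'
  -- Only the double coset containing `g` contributes, and there the fibre count cancels the order
  -- of the stabilizer. Summing over `g` then counts all of `P' × P` for each representative.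
  have hg : ∀ g, Φ g = ∑ t, (Nat.card {p : P' × P // p.1.1 * w t * p.2.1 = g} : ℂ) *
      (Nat.card {s : G // s ∈ P ∧ w t * s * (w t)⁻¹ ∈ P'} : ℂ)⁻¹ * Φ (w t) := by
    intro g
    obtain ⟨t, p', hp', p, hp, h⟩ := hcover g
    rw [Finset.sum_eq_single t]
    · rw [card_doubleCoset_fiber P' P (w t) g p' p hp' hp h, mul_inv_cancel₀ (hS t), one_mul, ← h,
        hΦ _ _ _ hp' hp]
    · intro t' _ ht'
      have : IsEmpty {p : P' × P // p.1.1 * w t' * p.2.1 = g} := by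
        refine ⟨fun q => ht' (hdisj t' t (p'⁻¹ * q.1.1.1) (q.1.2.1 * p⁻¹)
          (P'.mul_mem (P'.inv_mem hp') q.1.1.2) (P.mul_mem q.1.2.2 (P.inv_mem hp)) ?_)⟩
        have h1 : p'⁻¹ * q.1.1.1 * w t' * (q.1.2.1 * p⁻¹) =
          p'⁻¹ * (q.1.1.1 * w t' * q.1.2.1) * p⁻¹ := by group
        rw [h1, q.2, ← h]
        group
      simp
    · simp
  rw [Finset.sum_congr rfl fun g _ => hg g, Finset.sum_comm]
  refine Finset.sum_congr rfl fun t _ => ?_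
  rw [← Finset.sum_mul, ← Finset.sum_mul, hfib]

end DoubleCosets

/-! ### Parabolic subgroups -/

section Parabolic

variable {F : Type*} [Field F]

/-- The vectors supported on the image of the left summand. -/
def coordSub {α β ι : Type*} (e : α ⊕ β ≃ ι) : Submodule F (ι → F) where
  carrier := {v | ∀ b, v (e (Sum.inr b)) = 0}
  add_mem' hv hw b := by rw [Pi.add_apply, hv b, hw b, add_zero]
  zero_mem' _ := rfl
  smul_mem' c v hv b := by rw [Pi.smul_apply, hv b, smul_zero]

/-- A vector supported on the image of the left summand is a function on the left summand. -/
def coordSubEquiv {α β ι : Type*} (e : α ⊕ β ≃ ι) : coordSub (F := F) e ≃ₗ[F] (α → F) where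
  toFun v a := v.1 (e (Sum.inl a))
  map_add' _ _ := rfl
  map_smul' _ _ := rfl
  invFun u := ⟨fun i => Sum.elim u (fun _ => 0) (e.symm i), fun b => by simp⟩
  left_inv v := by
    refine Subtype.ext <| funext fun i => ?_
    obtain ⟨a | b, rfl⟩ := e.surjective i
    · simp
    · simpa using (v.2 b).symm
  right_inv u := by simp

theorem finrank_coordSub {α β ι : Type*} [Fintype α] (e : α ⊕ β ≃ ι) :
    Module.finrank F (coordSub (F := F) e) = Fintype.card α := by
  rw [(coordSubEquiv e).finrank_eq, Module.finrank_fintype_fun_eq_card]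

variable {k l n : ℕ}

theorem inPar_iff_col_mem (h : k + l = n) (x : gl F n) :
    InPar h x ↔ ∀ a, x.col (split h (Sum.inl a)) ∈ coordSub (F := F) (split h) := by
  constructor
  · intro hx a b
    exact congrFun (congrFun hx b) a
  · intro hx
    ext b a
    exact hx a b

theorem inPar_iff_mulVec_mem (h : k + l = n) (x : gl F n) :
    InPar h x ↔ ∀ v ∈ coordSub (F := F) (split h), x.mulVec v ∈ coordSub (F := F) (split h) := by
  rw [inPar_iff_col_mem]
  constructor
  · intro hx v hv b
    rw [Matrix.mulVec, dotProduct, ← (split h).sum_comp, Fintype.sum_sum_type,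
      Finset.sum_eq_zero, Finset.sum_eq_zero, add_zero]
    · intro c _
      rw [hv c, mul_zero]
    · intro a _
      rw [show x (split h (Sum.inr b)) (split h (Sum.inl a)) = 0 from hx a b, zero_mul]
  · intro hx a
    have h1 := hx (Pi.single (split h (Sum.inl a)) 1) (fun b => by simp)
    rwa [Matrix.mulVec_single_one] at h1

theorem inPar_mul (h : k + l = n) {x y : gl F n} (hx : InPar h x) (hy : InPar h y) :
    InPar h (x * y) := by
  rw [inPar_iff_mulVec_mem] at hx hy ⊢
  intro v hv
  rw [← Matrix.mulVec_mulVec]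
  exact hx _ (hy _ hv)

theorem inPar_one (h : k + l = n) : InPar h (1 : gl F n) := by
  rw [inPar_iff_mulVec_mem]
  intro v hv
  rwa [Matrix.one_mulVec]

theorem proj_mul_fst (h : k + l = n) (x : gl F n) {y : gl F n} (hy : InPar h y) :
    (proj h (x * y)).1 = (proj h x).1 * (proj h y).1 := by
  have h1 : blocks h (x * y) = blocks h x * blocks h y :=
    map_mul (Matrix.reindexRingEquiv F (split h).symm) x y
  rw [← Matrix.fromBlocks_toBlocks (blocks h x), ← Matrix.fromBlocks_toBlocks (blocks h y),
    Matrix.fromBlocks_multiply, show (blocks h y).toBlocks₂₁ = 0 from hy] at h1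
  simp only [proj, h1, Matrix.toBlocks_fromBlocks₁₁, Matrix.mul_zero, add_zero]

theorem proj_mul_snd (h : k + l = n) {x : gl F n} (hx : InPar h x) (y : gl F n) :
    (proj h (x * y)).2 = (proj h x).2 * (proj h y).2 := by
  have h1 : blocks h (x * y) = blocks h x * blocks h y :=
    map_mul (Matrix.reindexRingEquiv F (split h).symm) x y
  rw [← Matrix.fromBlocks_toBlocks (blocks h x), ← Matrix.fromBlocks_toBlocks (blocks h y),
    Matrix.fromBlocks_multiply, show (blocks h x).toBlocks₂₁ = 0 from hx] at h1
  simp only [proj, h1, Matrix.toBlocks_fromBlocks₂₂, Matrix.zero_mul, zero_add]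

theorem proj_one (h : k + l = n) : proj h (1 : gl F n) = (1, 1) := by
  have h1 : blocks h (1 : gl F n) = 1 := map_one (Matrix.reindexRingEquiv F (split h).symm)
  rw [proj, h1, ← Matrix.fromBlocks_one, Matrix.toBlocks_fromBlocks₁₁,
    Matrix.toBlocks_fromBlocks₂₂]

variable [Fintype F]

/-- The parabolic subgroup of invertible block upper triangular matrices. -/
def parabolic (h : k + l = n) : Subgroup (GL (Fin n) F) where
  carrier := {g | InPar h g.val}
  mul_mem' hx hy := inPar_mul h hx hy
  one_mem' := inPar_one h
  inv_mem' := by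
    intro g hg
    -- In a finite group the inverse is a power, so closure under products suffices.
    have h1 : g⁻¹ = g ^ (orderOf g - 1) := by
      rw [inv_eq_iff_mul_eq_one, ← pow_succ', Nat.sub_add_cancel (orderOf_pos g),
        pow_orderOf_eq_one]
    rw [h1]
    generalize orderOf g - 1 = r
    induction r with
    | zero => exact inPar_one h
    | succ r ih => rw [pow_succ]; exact inPar_mul h ih hg

theorem mem_parabolic (h : k + l = n) (g : GL (Fin n) F) : g ∈ parabolic h ↔ InPar h g.val :=
  Iff.rfl

theorem inPar_conj (h : k + l = n) {p : GL (Fin n) F} (hp : p ∈ parabolic h) (x : gl F n) :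
    InPar h (p.val * x * p⁻¹.val) ↔ InPar h x := by
  constructor
  · intro hx
    have := inPar_mul h (inPar_mul h ((parabolic h).inv_mem hp) hx) hp
    simpa [mul_assoc] using this
  · intro hx
    exact inPar_mul h (inPar_mul h hp hx) ((parabolic h).inv_mem hp)

/-- The projection to the diagonal blocks is multiplicative on the parabolic subalgebra, so
conjugation by `p` becomes conjugation by its two invertible diagonal blocks. -/
theorem apply_proj_conj (h : k + l = n) {p : GL (Fin n) F} (hp : p ∈ parabolic h) {x : gl F n}
    (hx : InPar h x) (f : InvLevi F k l) :
    f.1 (proj h (p.val * x * p⁻¹.val)) = f.1 (proj h x) := by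
  have hp' : InPar h p⁻¹.val := (parabolic h).inv_mem hp
  have h1 : ∀ q : GL (Fin n) F, q ∈ parabolic h → (proj h q.val).1 * (proj h q⁻¹.val).1 = 1 := by
    intro q hq
    rw [← proj_mul_fst h _ ((parabolic h).inv_mem hq), Units.mul_inv, proj_one]
  have h2 : ∀ q : GL (Fin n) F, q ∈ parabolic h → (proj h q.val).2 * (proj h q⁻¹.val).2 = 1 := by
    intro q hq
    rw [← proj_mul_snd h hq, Units.mul_inv, proj_one]
  have := f.2 ⟨(proj h p.val).1, (proj h p⁻¹.val).1, h1 p hp, by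
      simpa using h1 p⁻¹ ((parabolic h).inv_mem hp)⟩
    ⟨(proj h p.val).2, (proj h p⁻¹.val).2, h2 p hp, by
      simpa using h2 p⁻¹ ((parabolic h).inv_mem hp)⟩ (proj h x).1 (proj h x).2
  refine Eq.trans (congrArg f.1 (Prod.ext ?_ ?_)) this
  · rw [proj_mul_fst h _ hp', proj_mul_fst h _ hx]
    rfl
  · rw [proj_mul_snd h (inPar_mul h hp hx), proj_mul_snd h hp]
    rfl

end Parabolic

/-! ### The relative position of two parabolic subgroups -/

section RelativePosition

variable {F : Type*} [Field F]

/-- The decomposition of `n` indices into four consecutive intervals. -/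
def splitFour {i j m r k l n : ℕ} (hij : i + j = k) (hmr : m + r = l) (h : k + l = n) :
    (Fin i ⊕ Fin j) ⊕ (Fin m ⊕ Fin r) ≃ Fin n :=
  (Equiv.sumCongr (split hij) (split hmr)).trans (split h)

/-- The permutation of `n` indices which interchanges the two middle intervals. -/
def swapPerm {i j m r k l k' l' n : ℕ} (hij : i + j = k) (hmr : m + r = l) (h : k + l = n)
    (him : i + m = k') (hjr : j + r = l') (h' : k' + l' = n) : Equiv.Perm (Fin n) :=
  (splitFour hij hmr h).symm.trans
    ((Equiv.sumSumSumComm _ _ _ _).trans (splitFour him hjr h'))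

theorem mem_coordSub_split_iff {i j m r k l n : ℕ} (hij : i + j = k) (hmr : m + r = l)
    (h : k + l = n) (v : Fin n → F) :
    v ∈ coordSub (F := F) (split h) ↔ ∀ c, v (splitFour hij hmr h (Sum.inr c)) = 0 := by
  refine ⟨fun hv c => hv (split hmr c), fun hv b => ?_⟩
  obtain ⟨c, rfl⟩ := (split hmr).surjective b
  exact hv c

theorem swapPerm_symm_splitFour {i j m r k l k' l' n : ℕ} (hij : i + j = k) (hmr : m + r = l)
    (h : k + l = n) (him : i + m = k') (hjr : j + r = l') (h' : k' + l' = n)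
    (c : (Fin i ⊕ Fin m) ⊕ (Fin j ⊕ Fin r)) :
    (swapPerm hij hmr h him hjr h').symm (splitFour him hjr h' c) =
      splitFour hij hmr h ((Equiv.sumSumSumComm _ _ _ _).symm c) := by
  simp [swapPerm]

theorem exists_isCompl_of_le {V : Type*} [AddCommGroup V] [Module F V] [FiniteDimensional F V]
    {A W : Submodule F V} (h : A ≤ W) : ∃ B, A ⊔ B = W ∧
      Module.finrank F A + Module.finrank F B = Module.finrank F W := by
  obtain ⟨B, hB⟩ := Submodule.exists_isCompl A
  refine ⟨B ⊓ W, ?_, ?_⟩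
  · rw [← sup_inf_assoc_of_le _ h, hB.sup_eq_top, top_inf_eq]
  · have h1 := Submodule.finrank_sup_add_finrank_inf_eq A (B ⊓ W)
    rw [← sup_inf_assoc_of_le _ h, hB.sup_eq_top, top_inf_eq, ← inf_assoc, hB.inf_eq_bot,
      bot_inf_eq, finrank_bot, add_zero] at h1
    exact h1.symm

/-- Two subspaces have a common adapted basis. -/
theorem exists_adapted_basis {V : Type*} [AddCommGroup V] [Module F V] [FiniteDimensional F V]
    (W X : Submodule F V) : ∃ (i j m r : ℕ) (b : (Fin i ⊕ Fin j) ⊕ (Fin m ⊕ Fin r) → V),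
      i + j = Module.finrank F W ∧ i + m = Module.finrank F X ∧
      i + j + (m + r) = Module.finrank F V ∧ ⊤ ≤ Submodule.span F (Set.range b) ∧
      (∀ s, b (Sum.inl s) ∈ W) ∧
      ∀ s, b ((Equiv.sumSumSumComm _ _ _ _).symm (Sum.inl s)) ∈ X := by
  -- The basis joins bases of `W ⊓ X`, of a complement `B` of it in `W`, of a complement `C` of it
  -- in `X`, and of a complement `D` of `W ⊔ X`; their sizes are `i, j, m, r` in this order.
  obtain ⟨B, hB, hB'⟩ := exists_isCompl_of_le (inf_le_left : W ⊓ X ≤ W)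
  obtain ⟨C, hC, hC'⟩ := exists_isCompl_of_le (inf_le_right : W ⊓ X ≤ X)
  obtain ⟨D, hD, hD'⟩ := exists_isCompl_of_le (le_top : W ⊔ X ≤ ⊤)
  have hBW : B ≤ W := hB ▸ le_sup_right
  have hCX : C ≤ X := hC ▸ le_sup_right
  have hWX := Submodule.finrank_sup_add_finrank_inf_eq W X
  rw [finrank_top] at hD'
  let bas (Y : Submodule F V) : Fin (Module.finrank F Y) → V := fun a => Module.finBasis F Y a
  have hbas : ∀ Y, Submodule.span F (Set.range (bas Y)) = Y := by
    intro Y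
    have : Set.range (bas Y) = Y.subtype '' Set.range (Module.finBasis F Y) := by
      rw [← Set.range_comp]
      rfl
    rw [this, Submodule.span_image, (Module.finBasis F Y).span_eq, Submodule.map_subtype_top]
  have hmem : ∀ Y a, bas Y a ∈ Y := fun Y a => Subtype.property _
  refine ⟨_, _, _, _, Sum.elim (Sum.elim (bas (W ⊓ X)) (bas B)) (Sum.elim (bas C) (bas D)),
    hB', hC', by omega, ?_, ?_, ?_⟩
  · rw [Set.Sum.elim_range, Set.Sum.elim_range, Set.Sum.elim_range, Submodule.span_union,
      Submodule.span_union, Submodule.span_union, hbas, hbas, hbas, hbas, ← hD]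
    refine sup_le (sup_le ?_ ?_) (le_sup_of_le_right le_sup_right)
    · rw [hB]
      exact le_sup_left
    · conv_lhs => rw [← hC]
      exact sup_le (le_sup_of_le_left le_sup_left) (le_sup_of_le_right le_sup_left)
  · rintro (a | a)
    · exact (hmem _ a).1
    · exact hBW (hmem _ a)
  · rintro (a | a)
    · exact (hmem _ a).2
    · exact hCX (hmem _ a)

variable {k l k' l' n : ℕ}

theorem permGL_mulVec (e : Equiv.Perm (Fin n)) (v : Fin n → F) :
    (permGL e).val.mulVec v = v ∘ e.symm := by
  change (Equiv.toPEquiv e.symm).toMatrix.mulVec v = _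
  rw [PEquiv.toMatrix_toPEquiv_mulVec]

theorem col_mul_permGL_inv (x : gl F n) (e : Equiv.Perm (Fin n)) (a : Fin n) :
    (x * (permGL e)⁻¹.val).col a = x.col (e.symm a) := by
  change (x * (Equiv.toPEquiv e).toMatrix).col a = _
  rw [PEquiv.mul_toMatrix_toPEquiv]
  rfl

/-- The sizes of the four intervals for the possible relative positions of a `k`-dimensional and a
`k'`-dimensional subspace of a space of dimension `k + l = k' + l'`. -/
structure Position (k l k' l' : ℕ) where
  (i j m r : ℕ)
  hij : i + j = k
  hmr : m + r = l
  him : i + m = k'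
  hjr : j + r = l'

theorem Position.ext_i {t t' : Position k l k' l'} (h : t.i = t'.i) : t = t' := by
  obtain ⟨i, j, m, r, hij, hmr, him, hjr⟩ := t
  obtain ⟨i', j', m', r', hij', hmr', him', hjr'⟩ := t'
  obtain rfl : i = i' := h
  obtain rfl : j = j' := by omega
  obtain rfl : m = m' := by omega
  obtain rfl : r = r' := by omega
  rfl

/-- The permutation matrix which represents a relative position. -/
def Position.perm (t : Position k l k' l') (h : k + l = n) (h' : k' + l' = n) : GL (Fin n) F :=
  permGL (swapPerm t.hij t.hmr h t.him t.hjr h')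

/-- The number `i` determines the whole table, so this dimension, being constant on double cosets,
separates the representatives. -/
theorem Position.finrank_inf (t : Position k l k' l') (h : k + l = n) (h' : k' + l' = n) :
    Module.finrank F ((coordSub (split h) ⊓ (coordSub (split h')).comap
      (t.perm (F := F) h h').val.mulVecLin : Submodule F (Fin n → F))) = t.i := by
  -- The intersection is the coordinate subspace of the first interval; reassociating groups the
  -- other three intervals as its complement.
  have h1 := finrank_coordSub (F := F)
    ((Equiv.sumAssoc _ _ _).symm.trans (splitFour t.hij t.hmr h))
  rw [Fintype.card_fin] at h1
  refine Eq.trans (congrArg (fun Y : Submodule F (Fin n → F) => Module.finrank F Y) ?_) h1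
  ext v
  rw [Submodule.mem_inf, Submodule.mem_comap, Matrix.mulVecLin_apply, Position.perm, permGL_mulVec,
    mem_coordSub_split_iff t.hij t.hmr, mem_coordSub_split_iff t.him t.hjr]
  simp only [Function.comp_apply, swapPerm_symm_splitFour]
  constructor
  · rintro ⟨h2, h3⟩ (c | c)
    · exact h3 (Sum.inl c)
    · exact h2 c
  · intro h2
    refine ⟨fun c => h2 (Sum.inr c), ?_⟩
    rintro (c | c)
    · exact h2 (Sum.inl c)
    · exact h2 (Sum.inr (Sum.inr c))

variable [Fintype F]

/-- The relative position of the standard subspace of type `(k, l)` and the preimage of the standard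
subspace of type `(k', l')` under `g` is an invariant of the double coset of `g`. -/
theorem finrank_inf_mul_mul (h : k + l = n) (h' : k' + l' = n) {p' p : GL (Fin n) F}
    (hp' : p' ∈ parabolic h') (hp : p ∈ parabolic h) (g : GL (Fin n) F) :
    Module.finrank F ((coordSub (split h) ⊓ (coordSub (split h')).comap
      (p' * g * p).val.mulVecLin : Submodule F (Fin n → F))) =
    Module.finrank F ((coordSub (split h) ⊓ (coordSub (split h')).comap
      g.val.mulVecLin : Submodule F (Fin n → F))) := by
  have hmem : ∀ {k l : ℕ} (h : k + l = n) {q : GL (Fin n) F}, q ∈ parabolic h → ∀ v,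
      q.val.mulVec v ∈ coordSub (F := F) (split h) ↔ v ∈ coordSub (F := F) (split h) := by
    intro k l h q hq v
    refine ⟨fun hv => ?_, (inPar_iff_mulVec_mem h _).1 hq v⟩
    have := (inPar_iff_mulVec_mem h _).1 ((parabolic h).inv_mem hq) _ hv
    rwa [Matrix.mulVec_mulVec, Units.inv_mul, Matrix.one_mulVec] at this
  have heq : (coordSub (split h) ⊓ (coordSub (split h')).comap
      (p' * g * p).val.mulVecLin : Submodule F (Fin n → F)) =
      (coordSub (split h) ⊓ (coordSub (split h')).comap
        g.val.mulVecLin : Submodule F (Fin n → F)).comap p.val.mulVecLin := by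
    ext v
    simp only [Submodule.mem_inf, Submodule.mem_comap, Matrix.mulVecLin_apply, Units.val_mul,
      ← Matrix.mulVec_mulVec, hmem h hp, hmem h' hp']
  rw [heq]
  have hinj : Function.Injective p.val.mulVecLin := by
    intro v w hvw
    simpa [Matrix.mulVec_mulVec] using congrArg p⁻¹.val.mulVec hvw
  let e : (Fin n → F) ≃ₗ[F] (Fin n → F) := LinearEquiv.ofInjectiveEndo _ hinj
  exact LinearEquiv.finrank_eq (e.ofSubmodule' _)

theorem position_unique (h : k + l = n) (h' : k' + l' = n) (t t' : Position k l k' l')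
    (p' p : GL (Fin n) F) (hp' : p' ∈ parabolic h') (hp : p ∈ parabolic h)
    (heq : p' * t.perm h h' * p = t'.perm h h') : t = t' := by
  refine Position.ext_i ?_
  rw [← t.finrank_inf (F := F) h h', ← finrank_inf_mul_mul h h' hp' hp, heq, t'.finrank_inf]

/-- Take a basis adapted to the standard `k`-dimensional subspace and to the preimage under `g` of
the standard `k'`-dimensional one. The matrix `q` with this basis as columns preserves the first
subspace, and `g q w⁻¹` preserves the second because `w⁻¹` moves its coordinates to the intervals
`i` and `m`. Hence `g = (g q w⁻¹) w q⁻¹`. -/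
theorem exists_eq_mul_perm_mul (h : k + l = n) (h' : k' + l' = n) (g : GL (Fin n) F) :
    ∃ t : Position k l k' l', ∃ p' ∈ parabolic h', ∃ p ∈ parabolic h, p' * t.perm h h' * p = g := by
  obtain ⟨i, j, m, r, b, hij, him, htot, hspan, hW, hX⟩ := exists_adapted_basis
    (coordSub (F := F) (split h)) ((coordSub (F := F) (split h')).comap g.val.mulVecLin)
  have hinj : Function.Injective g.val.mulVecLin := by
    intro v w hvw
    simpa [Matrix.mulVec_mulVec] using congrArg g⁻¹.val.mulVec hvw
  have hfr : Module.finrank F ((coordSub (F := F) (split h')).comap g.val.mulVecLin) = k' := by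
    let e : (Fin n → F) ≃ₗ[F] (Fin n → F) := LinearEquiv.ofInjectiveEndo _ hinj
    exact (LinearEquiv.finrank_eq (e.ofSubmodule' _)).trans
      ((finrank_coordSub _).trans (Fintype.card_fin _))
  rw [hfr] at him
  rw [finrank_coordSub, Fintype.card_fin] at hij
  rw [Module.finrank_fintype_fun_eq_card, Fintype.card_fin] at htot
  let t : Position k l k' l' := ⟨i, j, m, r, hij, by omega, him, by omega⟩
  let Q : gl F n := Matrix.of fun a c => b ((splitFour t.hij t.hmr h).symm c) a
  have hQcol : ∀ c, Q.col (splitFour t.hij t.hmr h c) = b c := by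
    intro c
    ext a
    simp [Q]
  have hQ : IsUnit Q := by
    rw [← Matrix.linearIndependent_cols_iff_isUnit]
    have hb : LinearIndependent F b := by
      refine linearIndependent_of_top_le_span_of_card_eq_finrank hspan ?_
      simp [htot]
    exact hb.comp _ (splitFour t.hij t.hmr h).symm.injective
  obtain ⟨q, hq⟩ := hQ
  have hqP : q ∈ parabolic h := by
    rw [mem_parabolic, inPar_iff_col_mem, hq]
    intro a
    obtain ⟨s, rfl⟩ := (split t.hij).surjective a
    rw [show split h (Sum.inl (split t.hij s)) = splitFour t.hij t.hmr h (Sum.inl s) from rfl,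
      hQcol]
    exact hW s
  have hp' : g * q * (t.perm h h')⁻¹ ∈ parabolic h' := by
    rw [mem_parabolic, inPar_iff_col_mem]
    intro a
    obtain ⟨s, rfl⟩ := (split t.him).surjective a
    have h1 : (g * q * (t.perm h h')⁻¹).val.col (split h' (Sum.inl (split t.him s))) =
        g.val.mulVec (b ((Equiv.sumSumSumComm _ _ _ _).symm (Sum.inl s))) := by
      rw [← hQcol, ← swapPerm_symm_splitFour t.hij t.hmr h t.him t.hjr h', ← hq]
      exact col_mul_permGL_inv (g * q).val _ _
    rw [h1]
    exact hX s
  exact ⟨t, _, hp', _, (parabolic h).inv_mem hqP, by group⟩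

end RelativePosition

/-! ### The algebra structure -/

section Algebra

variable {F : Type*} [Field F] [Fintype F] [DecidableEq F]

/-- The pairing as a map from `C(q)` to the convolution algebra of its dual. -/
def toDual (a : CSpace F) : WithConv (CSpace F →ₗ[ℂ] ℂ) := WithConv.toConv (pairing F a)

theorem toDual_injective : Function.Injective (toDual (F := F)) := by
  intro a b hab
  have h1 : pairing F a = pairing F b := WithConv.toConv_injective hab
  rw [← sub_eq_zero]
  refine pairing_separating _ fun p => ?_
  rw [pairing_comm, map_sub, h1, sub_self]
  rfl

instance : Mul (CSpace F) := ⟨fun a b => mulMap F (a ⊗ₜ b)⟩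

instance : One (CSpace F) := ⟨unitMap F 1⟩

theorem mul_def (a b : CSpace F) : a * b = mulMap F (a ⊗ₜ b) := rfl

omit [Fintype F] [DecidableEq F] in
theorem one_def : (1 : CSpace F) = unitMap F 1 := rfl

theorem toDual_mul (a b : CSpace F) : toDual (a * b) = toDual a * toDual b :=
  WithConv.ofConv_injective <| LinearMap.ext fun c => pairing_mulMap a b c

theorem toDual_one : toDual (1 : CSpace F) = 1 := by
  refine WithConv.ofConv_injective <| LinearMap.ext fun c => ?_
  change pairing F (DirectSum.lof ℂ ℕ (fun n => Inv F n) 0 _) c = counitMap F c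
  rw [pairing_lof, counit_eq_ev, Fintype.sum_subsingleton _ 0, Fintype.card_unique]
  simp [zeroEquiv]

/-- The multiplicative axioms are inherited from the convolution algebra of the dual through the
injective map `toDual`; commutativity there is cocommutativity of the coalgebra. -/
instance : CommRing (CSpace F) where
  __ := (inferInstance : AddCommGroup (CSpace F))
  mul_assoc a b c := toDual_injective (by simp only [toDual_mul, mul_assoc])
  one_mul a := toDual_injective (by rw [toDual_mul, toDual_one, one_mul])
  mul_one a := toDual_injective (by rw [toDual_mul, toDual_one, mul_one])
  mul_comm a b := toDual_injective (by rw [toDual_mul, toDual_mul, mul_comm])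
  left_distrib a b c := by simp only [mul_def, TensorProduct.tmul_add, map_add]
  right_distrib a b c := by simp only [mul_def, TensorProduct.add_tmul, map_add]
  zero_mul a := by simp only [mul_def, TensorProduct.zero_tmul, map_zero]
  mul_zero a := by simp only [mul_def, TensorProduct.tmul_zero, map_zero]

instance : Algebra ℂ (CSpace F) :=
  Algebra.ofModule
    (fun c a b => by simp only [mul_def, ← TensorProduct.smul_tmul', map_smul])
    (fun c a b => by simp only [mul_def, TensorProduct.tmul_smul, map_smul])

theorem algebraMap_eq (c : ℂ) : algebraMap ℂ (CSpace F) c = unitMap F c := by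
  rw [Algebra.algebraMap_eq_smul_one, one_def, ← map_smul, smul_eq_mul, mul_one]

omit [DecidableEq F] in
theorem comul_eq (a : CSpace F) : Coalgebra.comul (R := ℂ) a = comulMap F a := rfl

end Algebra

/-! ### Compatibility of the product and the coproduct -/

section Mackey

variable {F : Type*} [Field F] [Fintype F] [DecidableEq F]

omit [DecidableEq F] in
theorem ev₂_comulMap_lof_of_ne {i m k : ℕ} (h : i + m ≠ k) (x : gl F i) (z : gl F m)
    (f : Inv F k) : ev₂ x z (comulMap F (DirectSum.lof ℂ ℕ (fun n => Inv F n) k f)) = 0 := by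
  rw [ev₂_comulMap, Finset.sum_eq_zero, mul_zero]
  intro u _
  exact ev_lof_of_ne (by simpa using h) _ _

/-- The contraction of four tensors, in the degrees `((i, m), (j, r))`, along the four edges of a
square. -/
def fourSum (T₁ T₂ T₃ T₄ : CSpace F ⊗[ℂ] CSpace F) (p : (ℕ × ℕ) × (ℕ × ℕ)) : ℂ :=
  ((Fintype.card (GL (Fin p.1.1) F) : ℂ) * Fintype.card (GL (Fin p.2.1) F) *
    (Fintype.card (GL (Fin p.1.2) F) * Fintype.card (GL (Fin p.2.2) F)))⁻¹ *
    ∑ x : gl F p.1.1, ∑ y : gl F p.2.1, ∑ z : gl F p.1.2, ∑ w : gl F p.2.2,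
      ev₂ x y T₁ * ev₂ z w T₂ * (ev₂ x z T₃ * ev₂ y w T₄)

theorem fourSum_lof_of_ne {i j m r : ℕ} (f₁ : Inv F i) (f₂ : Inv F j) (g₁ : Inv F m) (g₂ : Inv F r)
    (T₃ T₄ : CSpace F ⊗[ℂ] CSpace F) {p : (ℕ × ℕ) × (ℕ × ℕ)} (hp : p ≠ ((i, m), (j, r))) :
    fourSum (DirectSum.lof ℂ ℕ (fun n => Inv F n) i f₁ ⊗ₜ DirectSum.lof ℂ ℕ (fun n => Inv F n) j f₂)
      (DirectSum.lof ℂ ℕ (fun n => Inv F n) m g₁ ⊗ₜ DirectSum.lof ℂ ℕ (fun n => Inv F n) r g₂)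
      T₃ T₄ p = 0 := by
  obtain ⟨⟨i', m'⟩, j', r'⟩ := p
  rw [fourSum, Finset.sum_eq_zero, mul_zero]
  intro x _
  refine Finset.sum_eq_zero fun y _ => Finset.sum_eq_zero fun z _ =>
    Finset.sum_eq_zero fun w _ => ?_
  rw [ev₂_tmul, ev₂_tmul]
  by_cases h1 : i' = i
  · by_cases h2 : m' = m
    · by_cases h3 : j' = j
      · have h4 : r' ≠ r := fun h4 => hp (by rw [h1, h2, h3, h4])
        rw [ev_lof_of_ne (by simpa using h4) w, mul_zero, mul_zero, zero_mul]
      · rw [ev_lof_of_ne (by simpa using h3) y, mul_zero, zero_mul, zero_mul]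
    · rw [ev_lof_of_ne (by simpa using h2) z, zero_mul, mul_zero, zero_mul]
  · rw [ev_lof_of_ne (by simpa using h1) x, zero_mul, zero_mul, zero_mul]

theorem fourSum_lof {i j m r : ℕ} (f₁ : Inv F i) (f₂ : Inv F j) (g₁ : Inv F m) (g₂ : Inv F r)
    (T₃ T₄ : CSpace F ⊗[ℂ] CSpace F) :
    fourSum (DirectSum.lof ℂ ℕ (fun n => Inv F n) i f₁ ⊗ₜ DirectSum.lof ℂ ℕ (fun n => Inv F n) j f₂)
      (DirectSum.lof ℂ ℕ (fun n => Inv F n) m g₁ ⊗ₜ DirectSum.lof ℂ ℕ (fun n => Inv F n) r g₂)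
      T₃ T₄ ((i, m), (j, r)) =
    pairing₂ (DirectSum.lof ℂ ℕ (fun n => Inv F n) i f₁)
      (DirectSum.lof ℂ ℕ (fun n => Inv F n) m g₁) T₃ *
    pairing₂ (DirectSum.lof ℂ ℕ (fun n => Inv F n) j f₂)
      (DirectSum.lof ℂ ℕ (fun n => Inv F n) r g₂) T₄ := by
  rw [pairing₂_lof, pairing₂_lof, mul_mul_mul_comm, Finset.sum_mul_sum, fourSum]
  simp only [Finset.sum_mul_sum, ev₂_tmul, ev_gl, DirectSum.lof_apply]
  refine congrArg₂ (· * ·) ?_ ?_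
  · rw [mul_inv, mul_inv, mul_inv, mul_mul_mul_comm]
  · refine Finset.sum_congr rfl fun x _ => Finset.sum_congr rfl fun y _ =>
      Finset.sum_congr rfl fun z _ => Finset.sum_congr rfl fun w _ => ?_
    generalize ev₂ x z T₃ = t₃, ev₂ y w T₄ = t₄
    ring

theorem pairing₂_lof_comulMap_of_ne {i m k : ℕ} (hne : i + m ≠ k) (f : Inv F i) (g : Inv F m)
    (h : Inv F k) : pairing₂ (DirectSum.lof ℂ ℕ (fun n => Inv F n) i f)
      (DirectSum.lof ℂ ℕ (fun n => Inv F n) m g)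
      (comulMap F (DirectSum.lof ℂ ℕ (fun n => Inv F n) k h)) = 0 := by
  rw [pairing₂_lof]
  simp only [ev₂_comulMap_lof_of_ne hne, mul_zero, Finset.sum_const_zero]

omit [Fintype F] [DecidableEq F] in
theorem CSpace.tensor_induction {p : CSpace F ⊗[ℂ] CSpace F → Prop} (zero : p 0)
    (add : ∀ s t, p s → p t → p (s + t))
    (lof : ∀ i f j g, p (DirectSum.lof ℂ ℕ (fun n => Inv F n) i f ⊗ₜ
      DirectSum.lof ℂ ℕ (fun n => Inv F n) j g)) (T : CSpace F ⊗[ℂ] CSpace F) : p T := by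
  induction T with
  | zero => exact zero
  | add s t hs ht => exact add s t hs ht
  | tmul a b =>
  induction a using CSpace.induction with
  | zero => rwa [TensorProduct.zero_tmul]
  | add s t hs ht => rw [TensorProduct.add_tmul]; exact add _ _ hs ht
  | lof i f =>
  induction b using CSpace.induction with
  | zero => rwa [TensorProduct.tmul_zero]
  | add s t hs ht => rw [TensorProduct.tmul_add]; exact add _ _ hs ht
  | lof j g => exact lof i f j g

theorem fourSum_add_left (S T T₂ T₃ T₄ : CSpace F ⊗[ℂ] CSpace F) (p : (ℕ × ℕ) × (ℕ × ℕ)) :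
    fourSum (S + T) T₂ T₃ T₄ p = fourSum S T₂ T₃ T₄ p + fourSum T T₂ T₃ T₄ p := by
  simp only [fourSum, map_add, add_mul, Finset.sum_add_distrib, mul_add]

theorem fourSum_add_right (T₁ S T T₃ T₄ : CSpace F ⊗[ℂ] CSpace F) (p : (ℕ × ℕ) × (ℕ × ℕ)) :
    fourSum T₁ (S + T) T₃ T₄ p = fourSum T₁ S T₃ T₄ p + fourSum T₁ T T₃ T₄ p := by
  simp only [fourSum, map_add, add_mul, Finset.sum_add_distrib, mul_add]

/-- For homogeneous pure tensors, adjointness moves each of the two products onto the coproduct of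
`h` or `t`. At most one bidegree `p` then contributes, and `fourSum` keeps the expression additive
in `T₁` and `T₂`. -/
theorem pairing₂_mul {k' l' : ℕ} (h : Inv F k') (t : Inv F l') (T₁ T₂ : CSpace F ⊗[ℂ] CSpace F) :
    pairing₂ (DirectSum.lof ℂ ℕ (fun n => Inv F n) k' h)
      (DirectSum.lof ℂ ℕ (fun n => Inv F n) l' t) (T₁ * T₂) =
      ∑ p ∈ Finset.HasAntidiagonal.antidiagonal k' ×ˢ Finset.HasAntidiagonal.antidiagonal l',
        fourSum T₁ T₂ (comulMap F (DirectSum.lof ℂ ℕ (fun n => Inv F n) k' h))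
          (comulMap F (DirectSum.lof ℂ ℕ (fun n => Inv F n) l' t)) p := by
  induction T₁ using CSpace.tensor_induction with
  | zero => simp [fourSum]
  | add S T hS hT =>
    rw [add_mul, map_add, hS, hT, ← Finset.sum_add_distrib]
    simp only [fourSum_add_left]
  | lof i f₁ j f₂ =>
  induction T₂ using CSpace.tensor_induction with
  | zero => simp [fourSum]
  | add S T hS hT =>
    rw [mul_add, map_add, hS, hT, ← Finset.sum_add_distrib]
    simp only [fourSum_add_right]
  | lof m g₁ r g₂ =>
  rw [Algebra.TensorProduct.tmul_mul_tmul, pairing₂_tmul, pairing_comm,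
    pairing_comm (DirectSum.lof ℂ ℕ (fun n => Inv F n) l' t), mul_def, mul_def, pairing_mulMap,
    pairing_mulMap]
  by_cases hmem : i + m = k' ∧ j + r = l'
  · rw [Finset.sum_eq_single ((i, m), (j, r)), fourSum_lof]
    · exact fun p _ hp => fourSum_lof_of_ne _ _ _ _ _ _ hp
    · exact fun hn => absurd hmem (by simpa using hn)
  · rw [Finset.sum_eq_zero]
    · by_cases h1 : i + m = k'
      · rw [pairing₂_lof_comulMap_of_ne fun h2 => hmem ⟨h1, h2⟩, mul_zero]
      · rw [pairing₂_lof_comulMap_of_ne h1, zero_mul]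
    · rintro p hp
      refine fourSum_lof_of_ne _ _ _ _ _ _ ?_
      rintro rfl
      exact hmem (by simpa using hp)

end Mackey

/-! ### Intersections of parabolics and the Mackey formula -/

section Mackey

variable {F : Type*} [Field F] {k l k' l' n : ℕ}

instance : Fintype (Position k l k' l') :=
  @Fintype.ofFinite _ <| Finite.of_injective
    (fun t : Position k l k' l' => (⟨t.i, by have := t.hij; omega⟩ : Fin (k + 1)))
    fun _ _ h => Position.ext_i (congrArg Fin.val h)

/-- The block matrix stabilizing both of two subspaces in the relative position `t`. -/
def Position.matrix (t : Position k l k' l') (h : k + l = n) (x : gl F t.i)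
    (u : Matrix (Fin t.i) (Fin t.j) F) (y : gl F t.j) (r : Matrix (Fin t.i) (Fin t.m) F)
    (q : Matrix (Fin t.i) (Fin t.r) F) (s : Matrix (Fin t.j) (Fin t.r) F) (z : gl F t.m)
    (v : Matrix (Fin t.m) (Fin t.r) F) (w : gl F t.r) : gl F n :=
  Matrix.reindex (splitFour t.hij t.hmr h) (splitFour t.hij t.hmr h)
    (Matrix.fromBlocks (Matrix.fromBlocks x u 0 y) (Matrix.fromBlocks r q 0 s) 0
      (Matrix.fromBlocks z v 0 w))

theorem Position.matrix_eq (t : Position k l k' l') (h : k + l = n) (x : gl F t.i)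
    (u : Matrix (Fin t.i) (Fin t.j) F) (y : gl F t.j) (r : Matrix (Fin t.i) (Fin t.m) F)
    (q : Matrix (Fin t.i) (Fin t.r) F) (s : Matrix (Fin t.j) (Fin t.r) F) (z : gl F t.m)
    (v : Matrix (Fin t.m) (Fin t.r) F) (w : gl F t.r) :
    t.matrix h x u y r q s z v w = blockUpper h (blockUpper t.hij x u y)
      (Matrix.reindex (split t.hij) (split t.hmr) (Matrix.fromBlocks r q 0 s))
      (blockUpper t.hmr z v w) := by
  ext a b
  obtain ⟨a, rfl⟩ := (splitFour t.hij t.hmr h).surjective a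
  obtain ⟨b, rfl⟩ := (splitFour t.hij t.hmr h).surjective b
  rcases a with a | a <;> rcases b with b | b <;>
    simp [Position.matrix, blockUpper, splitFour]

theorem Position.conj_reindex (t : Position k l k' l') (h : k + l = n) (h' : k' + l' = n)
    (z : Matrix ((Fin t.i ⊕ Fin t.j) ⊕ (Fin t.m ⊕ Fin t.r))
      ((Fin t.i ⊕ Fin t.j) ⊕ (Fin t.m ⊕ Fin t.r)) F) :
    (t.perm h h').val * Matrix.reindex (splitFour t.hij t.hmr h) (splitFour t.hij t.hmr h) z *
      (t.perm h h')⁻¹.val = Matrix.reindex (splitFour t.him t.hjr h') (splitFour t.him t.hjr h')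
        (Matrix.reindex (Equiv.sumSumSumComm _ _ _ _) (Equiv.sumSumSumComm _ _ _ _) z) := by
  rw [Position.perm, permGL_conj]
  ext a b
  simp [swapPerm]

/-- Interchanging the middle intervals exchanges roles: `u` and `v`, inside the diagonal blocks for
`(k, l)`, become off-diagonal for `(k', l')`, while `r` and `s` move the other way. The block `q` is
off-diagonal on both sides. -/
theorem Position.conj_matrix (t : Position k l k' l') (h : k + l = n) (h' : k' + l' = n)
    (x : gl F t.i)
    (u : Matrix (Fin t.i) (Fin t.j) F) (y : gl F t.j) (r : Matrix (Fin t.i) (Fin t.m) F)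
    (q : Matrix (Fin t.i) (Fin t.r) F) (s : Matrix (Fin t.j) (Fin t.r) F) (z : gl F t.m)
    (v : Matrix (Fin t.m) (Fin t.r) F) (w : gl F t.r) :
    (t.perm h h').val * t.matrix h x u y r q s z v w * (t.perm h h')⁻¹.val =
      blockUpper h' (blockUpper t.him x r z)
        (Matrix.reindex (split t.him) (split t.hjr) (Matrix.fromBlocks u q 0 v))
        (blockUpper t.hjr y s w) := by
  rw [Position.matrix, Position.conj_reindex]
  ext a b
  obtain ⟨a, rfl⟩ := (splitFour t.him t.hjr h').surjective a
  obtain ⟨b, rfl⟩ := (splitFour t.him t.hjr h').surjective b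
  rcases a with (a | a) | (a | a) <;> rcases b with (b | b) | (b | b) <;>
    simp [blockUpper, splitFour]

theorem inPar_reindex_splitFour {i j m r : ℕ} (hij : i + j = k) (hmr : m + r = l) (h : k + l = n)
    (z : Matrix ((Fin i ⊕ Fin j) ⊕ (Fin m ⊕ Fin r)) ((Fin i ⊕ Fin j) ⊕ (Fin m ⊕ Fin r)) F) :
    InPar h (Matrix.reindex (splitFour hij hmr h) (splitFour hij hmr h) z) ↔
      z.toBlocks₂₁ = 0 := by
  have h1 : (blocks h (Matrix.reindex (splitFour hij hmr h) (splitFour hij hmr h) z)).toBlocks₂₁ =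
      Matrix.reindex (split hmr) (split hij) z.toBlocks₂₁ := by
    ext a b
    simp [blocks, splitFour, Matrix.toBlocks₂₁]
  rw [InPar, h1]
  exact (Equiv.eq_symm_apply _).symm

variable [Fintype F] [DecidableEq F]

omit [Field F] [Fintype F] [DecidableEq F] in
theorem sum_reorder {X U Y R Q S Z V W A : Type*} [Fintype X] [Fintype U] [Fintype Y] [Fintype R]
    [Fintype Q] [Fintype S] [Fintype Z] [Fintype V] [Fintype W] [AddCommMonoid A]
    (f : X → U → Y → R → Q → S → Z → V → W → A) :
    ∑ x, ∑ u, ∑ y, ∑ r, ∑ q, ∑ s, ∑ z, ∑ v, ∑ w, f x u y r q s z v w =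
      ∑ x, ∑ y, ∑ z, ∑ w, ∑ u, ∑ v, ∑ r, ∑ s, ∑ q, f x u y r q s z v w := by
  calc _ = ∑ p : X × U × Y × R × Q × S × Z × V × W, f p.1 p.2.1 p.2.2.1 p.2.2.2.1 p.2.2.2.2.1
        p.2.2.2.2.2.1 p.2.2.2.2.2.2.1 p.2.2.2.2.2.2.2.1 p.2.2.2.2.2.2.2.2 := by
        simp only [Fintype.sum_prod_type]
    _ = ∑ p : X × Y × Z × W × U × V × R × S × Q, f p.1 p.2.2.2.2.1 p.2.1 p.2.2.2.2.2.2.1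
        p.2.2.2.2.2.2.2.2 p.2.2.2.2.2.2.2.1 p.2.2.1 p.2.2.2.2.2.1 p.2.2.2.1 :=
        Fintype.sum_equiv ⟨fun (x, u, y, r, q, s, z, v, w) => (x, y, z, w, u, v, r, s, q),
          fun (x, y, z, w, u, v, r, s, q) => (x, u, y, r, q, s, z, v, w), fun _ => rfl,
          fun _ => rfl⟩ _ _ fun _ => rfl
    _ = _ := by simp only [Fintype.sum_prod_type]

/-- Given the first condition, the second kills exactly the lower left subblock of each of the three
remaining blocks. The order of summation puts the four diagonal blocks outside, so that the inner
sums can later be read as restrictions. -/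
theorem Position.sum_inPar_inPar (t : Position k l k' l') (h : k + l = n) (h' : k' + l' = n)
    {A : Type*} [AddCommMonoid A] (f : gl F n → A) :
    ∑ z, (if InPar h z then
      (if InPar h' ((t.perm h h').val * z * (t.perm h h')⁻¹.val) then f z else 0) else 0) =
      ∑ x : gl F t.i, ∑ y : gl F t.j, ∑ z : gl F t.m, ∑ w : gl F t.r,
        ∑ u : Matrix (Fin t.i) (Fin t.j) F, ∑ v : Matrix (Fin t.m) (Fin t.r) F,
        ∑ r : Matrix (Fin t.i) (Fin t.m) F, ∑ s : Matrix (Fin t.j) (Fin t.r) F,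
        ∑ q : Matrix (Fin t.i) (Fin t.r) F, f (t.matrix h x u y r q s z v w) := by
  let e := splitFour t.hij t.hmr h
  rw [← Equiv.sum_comp (Matrix.reindex e e)]
  simp only [e, inPar_reindex_splitFour, t.conj_reindex]
  rw [sum_toBlocks₂₁_eq_zero]
  have hiff : ∀ (a : Matrix (Fin t.i ⊕ Fin t.j) (Fin t.i ⊕ Fin t.j) F)
      (b : Matrix (Fin t.i ⊕ Fin t.j) (Fin t.m ⊕ Fin t.r) F)
      (d : Matrix (Fin t.m ⊕ Fin t.r) (Fin t.m ⊕ Fin t.r) F),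
      (Matrix.reindex (Equiv.sumSumSumComm _ _ _ _) (Equiv.sumSumSumComm _ _ _ _)
        (Matrix.fromBlocks a b 0 d)).toBlocks₂₁ = 0 ↔
      a.toBlocks₂₁ = 0 ∧ b.toBlocks₂₁ = 0 ∧ d.toBlocks₂₁ = 0 := by
    intro a b d
    constructor
    · intro h0
      refine ⟨?_, ?_, ?_⟩ <;> ext p q
      · exact congrFun (congrFun h0 (Sum.inl p)) (Sum.inl q)
      · exact congrFun (congrFun h0 (Sum.inl p)) (Sum.inr q)
      · exact congrFun (congrFun h0 (Sum.inr p)) (Sum.inr q)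
    · rintro ⟨h1, h2, h3⟩
      ext p q
      rcases p with p | p <;> rcases q with q | q
      · exact congrFun (congrFun h1 p) q
      · exact congrFun (congrFun h2 p) q
      · rfl
      · exact congrFun (congrFun h3 p) q
  simp only [hiff, ite_and]
  have hout : ∀ (a : Matrix (Fin t.i ⊕ Fin t.j) (Fin t.i ⊕ Fin t.j) F) (g : _ → _ → A),
      (∑ b : Matrix (Fin t.i ⊕ Fin t.j) (Fin t.m ⊕ Fin t.r) F,
        ∑ d : Matrix (Fin t.m ⊕ Fin t.r) (Fin t.m ⊕ Fin t.r) F,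
        if a.toBlocks₂₁ = 0 then (if b.toBlocks₂₁ = 0 then
          (if d.toBlocks₂₁ = 0 then g b d else 0) else 0) else 0) =
      if a.toBlocks₂₁ = 0 then
        ∑ b : Matrix (Fin t.i ⊕ Fin t.j) (Fin t.m ⊕ Fin t.r) F,
          if b.toBlocks₂₁ = 0 then
            ∑ d : Matrix (Fin t.m ⊕ Fin t.r) (Fin t.m ⊕ Fin t.r) F,
              (if d.toBlocks₂₁ = 0 then g b d else 0) else 0 else 0 := by
    intro a g
    split_ifs with h1
    · refine Finset.sum_congr rfl fun b _ => ?_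
      split_ifs with h2
      · rfl
      · exact Finset.sum_const_zero
    · simp only [Finset.sum_const_zero]
  simp only [hout, sum_toBlocks₂₁_eq_zero]
  exact sum_reorder fun x u y r q s z v w => f (t.matrix h x u y r q s z v w)

theorem Position.card_stabilizer (t : Position k l k' l') (h : k + l = n) (h' : k' + l' = n) :
    (Nat.card {g : GL (Fin n) F // g ∈ parabolic h ∧
      t.perm h h' * g * (t.perm h h')⁻¹ ∈ parabolic h'} : ℂ) =
      (Fintype.card (GL (Fin t.i) F) : ℂ) * Fintype.card (GL (Fin t.j) F) *
        (Fintype.card (GL (Fin t.m) F) * Fintype.card (GL (Fin t.r) F)) *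
        ((Fintype.card F : ℂ) ^ (t.i * t.j) * (Fintype.card F : ℂ) ^ (t.m * t.r) *
          ((Fintype.card F : ℂ) ^ (t.i * t.m) * (Fintype.card F : ℂ) ^ (t.j * t.r)) *
          (Fintype.card F : ℂ) ^ (t.i * t.r)) := by
  classical
  have h1 : (Nat.card {g : GL (Fin n) F // g ∈ parabolic h ∧
      t.perm h h' * g * (t.perm h h')⁻¹ ∈ parabolic h'} : ℂ) =
      ∑ z : gl F n, if IsUnit z then (if InPar h z then
        (if InPar h' ((t.perm h h').val * z * (t.perm h h')⁻¹.val) then 1 else 0) else 0)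
        else 0 := by
    rw [← sum_GL fun z => if InPar h z then
      (if InPar h' ((t.perm h h').val * z * (t.perm h h')⁻¹.val) then (1 : ℂ) else 0) else 0,
      Nat.card_eq_fintype_card, Fintype.card_subtype, Finset.card_filter, Nat.cast_sum]
    refine Finset.sum_congr rfl fun g _ => ?_
    simp only [mem_parabolic, ite_and, Units.val_mul]
    split_ifs <;> simp
  have h2 : (∑ z : gl F n, if IsUnit z then (if InPar h z then
        (if InPar h' ((t.perm h h').val * z * (t.perm h h')⁻¹.val) then (1 : ℂ) else 0) else 0)
        else 0) = ∑ z : gl F n, if InPar h z then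
        (if InPar h' ((t.perm h h').val * z * (t.perm h h')⁻¹.val) then
          (if IsUnit z then (1 : ℂ) else 0) else 0) else 0 := by
    refine Finset.sum_congr rfl fun z _ => ?_
    split_ifs <;> rfl
  rw [h1, h2, t.sum_inPar_inPar h h']
  have h3 : ∀ (x : gl F t.i) (y : gl F t.j) (z : gl F t.m) (w : gl F t.r),
      (if (IsUnit x ∧ IsUnit y) ∧ IsUnit z ∧ IsUnit w then (1 : ℂ) else 0) =
      (if IsUnit x then 1 else 0) * (if IsUnit y then 1 else 0) *
        ((if IsUnit z then 1 else 0) * (if IsUnit w then 1 else 0)) := by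
    intro x y z w
    by_cases hx : IsUnit x <;> by_cases hy : IsUnit y <;> by_cases hz : IsUnit z <;>
      simp [hx, hy, hz]
  simp only [Position.matrix_eq, isUnit_blockUpper, h3, Finset.sum_const, Finset.card_univ,
    nsmul_eq_mul, card_matrix, Fintype.card_fin, ← Finset.mul_sum, ← Finset.sum_mul, ← card_GL]
  ring

/-- The Mackey formula: the pairing of two induced functions. -/
theorem sum_hcIndFun_mul_hcIndFun (h : k + l = n) (h' : k' + l' = n) (A : InvLevi F k l)
    (B : InvLevi F k' l') :
    (Fintype.card (GL (Fin n) F) : ℂ)⁻¹ * ∑ x, hcIndFun h A.1 x * hcIndFun h' B.1 x =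
      ∑ t : Position k l k' l',
        (Nat.card {g : GL (Fin n) F // g ∈ parabolic h ∧
          t.perm h h' * g * (t.perm h h')⁻¹ ∈ parabolic h'} : ℂ)⁻¹ *
        ∑ z, if InPar h z then
          (if InPar h' ((t.perm h h').val * z * (t.perm h h')⁻¹.val) then
            A.1 (proj h z) * B.1 (proj h' ((t.perm h h').val * z * (t.perm h h')⁻¹.val)) else 0)
          else 0 := by
  -- Reciprocity removes the first induction; the sum over `g` in the second one is then cut into
  -- double cosets.
  have h1 := sum_hcIndFun_mul h A.1 (hcInd h' B)
  have h2 := sum_inPar h fun z => A.1 (proj h z) * hcIndFun h' B.1 z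
  simp only [proj_blockUpper] at h2
  rw [← card_parabolic h] at h1
  refine (h1.trans (congrArg _ h2.symm)).trans ?_
  let Φ : GL (Fin n) F → ℂ := fun g => ∑ z, if InPar h z then
    (if InPar h' (g.val * z * g⁻¹.val) then
      A.1 (proj h z) * B.1 (proj h' (g.val * z * g⁻¹.val)) else 0) else 0
  have hΦ : ∀ p' g p, p' ∈ parabolic h' → p ∈ parabolic h → Φ (p' * g * p) = Φ g := by
    intro p' g p hp' hp
    refine Fintype.sum_equiv ⟨fun z => p.val * z * p⁻¹.val, fun z => p⁻¹.val * z * p.val,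
      fun z => by simp [mul_assoc], fun z => by simp [mul_assoc]⟩ _ _ fun z => ?_
    have h3 : (p' * g * p).val * z * (p' * g * p)⁻¹.val =
        p'.val * (g.val * (p.val * z * p⁻¹.val) * g⁻¹.val) * p'⁻¹.val := by
      simp [mul_assoc]
    simp only [Equiv.coe_fn_mk, h3, inPar_conj h hp, inPar_conj h' hp']
    split_ifs with h4 h5
    · rw [apply_proj_conj h hp h4, apply_proj_conj h' hp' h5]
    · rfl
    · rfl
  have h3 : ∑ z, (if InPar h z then A.1 (proj h z) * hcIndFun h' B.1 z else 0) =
      (Nat.card (parabolic (F := F) h') : ℂ)⁻¹ * ∑ g, Φ g := by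
    simp only [hcIndFun, Φ]
    rw [Finset.sum_comm, Finset.mul_sum]
    refine Finset.sum_congr rfl fun z _ => ?_
    split_ifs
    · rw [mul_left_comm, Finset.mul_sum]
      refine congrArg₂ (· * ·) rfl (Finset.sum_congr rfl fun g _ => ?_)
      rw [mul_ite, mul_zero]
    · simp
  -- The factors `|P'|` and `|P|` from each double coset cancel the normalizations of the two
  -- inductions, leaving the inverse order of the stabilizer.
  rw [h3, sum_eq_sum_doubleCosets (parabolic h') (parabolic h)
    (fun t : Position k l k' l' => t.perm h h') (exists_eq_mul_perm_mul h h')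
    (fun t t' p' p hp' hp => position_unique h h' t t' p' p hp' hp) Φ hΦ]
  rw [Finset.mul_sum, Finset.mul_sum]
  refine Finset.sum_congr rfl fun t _ => ?_
  have h4 : (Nat.card (parabolic (F := F) h') : ℂ) ≠ 0 := Nat.cast_ne_zero.2 Nat.card_pos.ne'
  have h5 : (Nat.card (parabolic (F := F) h) : ℂ) ≠ 0 := Nat.cast_ne_zero.2 Nat.card_pos.ne'
  change (Nat.card (parabolic (F := F) h) : ℂ)⁻¹ * _ = _
  generalize (Nat.card (parabolic (F := F) h') : ℂ) = c' at h4
  generalize (Nat.card (parabolic (F := F) h) : ℂ) = c at h5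
  simp only [Φ]
  field_simp

omit [Fintype F] [DecidableEq F] in
theorem apply_blockUpper (h : k + l = n) (f : Inv F n) (x : gl F k) (u : Matrix (Fin k) (Fin l) F)
    (y : gl F l) : f.1 (blockUpper h x u y) =
      ev (Matrix.fromBlocks x u 0 y) (DirectSum.lof ℂ ℕ (fun n => Inv F n) n f) := by
  rw [← ev_blockUpper h, ev_gl, DirectSum.lof_apply]

/-- The sums over `u`, `v`, `r`, `s` are the unnormalized restrictions of `a`, `b`, `c`, `d`
respectively. The integrand does not involve `q`, whose sum gives `|F| ^ (i r)`. The stabilizer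
order supplies the four normalizing powers of `|F|`, this last power, and the orders of the four
diagonal groups. -/
theorem Position.fourSum_eq (t : Position k l k' l') (h : k + l = n) (h' : k' + l' = n)
    (a : Inv F k) (b : Inv F l) (c : Inv F k') (d : Inv F l') :
    (Nat.card {g : GL (Fin n) F // g ∈ parabolic h ∧
      t.perm h h' * g * (t.perm h h')⁻¹ ∈ parabolic h'} : ℂ)⁻¹ *
      (∑ z, if InPar h z then
        (if InPar h' ((t.perm h h').val * z * (t.perm h h')⁻¹.val) then
          (box k l a b).1 (proj h z) *
            (box k' l' c d).1 (proj h' ((t.perm h h').val * z * (t.perm h h')⁻¹.val)) else 0)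
        else 0) =
    fourSum (comulMap F (DirectSum.lof ℂ ℕ (fun n => Inv F n) k a))
      (comulMap F (DirectSum.lof ℂ ℕ (fun n => Inv F n) l b))
      (comulMap F (DirectSum.lof ℂ ℕ (fun n => Inv F n) k' c))
      (comulMap F (DirectSum.lof ℂ ℕ (fun n => Inv F n) l' d)) ((t.i, t.m), (t.j, t.r)) := by
  have hq : (Fintype.card F : ℂ) ≠ 0 := Nat.cast_ne_zero.2 Fintype.card_ne_zero
  rw [t.sum_inPar_inPar h h', t.card_stabilizer h h', fourSum]
  simp only [Position.conj_matrix]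
  simp only [Position.matrix_eq, proj_blockUpper, box_apply, apply_blockUpper, ev₂_comulMap,
    Fintype.card_fin, Finset.sum_const, Finset.card_univ, nsmul_eq_mul, card_matrix]
  rw [mul_inv, mul_assoc]
  refine congrArg₂ (· * ·) rfl ?_
  rw [Finset.mul_sum]
  refine Finset.sum_congr rfl fun x _ => ?_
  rw [Finset.mul_sum]
  refine Finset.sum_congr rfl fun y _ => ?_
  rw [Finset.mul_sum]
  refine Finset.sum_congr rfl fun z _ => ?_
  rw [Finset.mul_sum]
  refine Finset.sum_congr rfl fun w _ => ?_
  simp only [← Finset.mul_sum, ← Finset.sum_mul]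
  have h1 := pow_ne_zero (t.i * t.j) hq
  have h2 := pow_ne_zero (t.m * t.r) hq
  have h3 := pow_ne_zero (t.i * t.m) hq
  have h4 := pow_ne_zero (t.j * t.r) hq
  have h5 := pow_ne_zero (t.i * t.r) hq
  generalize (Fintype.card F : ℂ) ^ (t.i * t.j) = q1, (Fintype.card F : ℂ) ^ (t.m * t.r) = q2,
    (Fintype.card F : ℂ) ^ (t.i * t.m) = q3, (Fintype.card F : ℂ) ^ (t.j * t.r) = q4,
    (Fintype.card F : ℂ) ^ (t.i * t.r) = q5 at *
  field_simp

/-- Relative positions are exactly the pairs of antidiagonal entries that also satisfy `i + j = k`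
and `m + r = l`; all other terms vanish for degree reasons. If the total degrees differ, both sides
are zero. -/
theorem pairing_mul_mul (a : Inv F k) (b : Inv F l) (c : Inv F k') (d : Inv F l') :
    pairing F (DirectSum.lof ℂ ℕ (fun n => Inv F n) k a * DirectSum.lof ℂ ℕ (fun n => Inv F n) l b)
      (DirectSum.lof ℂ ℕ (fun n => Inv F n) k' c * DirectSum.lof ℂ ℕ (fun n => Inv F n) l' d) =
      ∑ p ∈ Finset.HasAntidiagonal.antidiagonal k' ×ˢ Finset.HasAntidiagonal.antidiagonal l',
        fourSum (comulMap F (DirectSum.lof ℂ ℕ (fun n => Inv F n) k a))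
          (comulMap F (DirectSum.lof ℂ ℕ (fun n => Inv F n) l b))
          (comulMap F (DirectSum.lof ℂ ℕ (fun n => Inv F n) k' c))
          (comulMap F (DirectSum.lof ℂ ℕ (fun n => Inv F n) l' d)) p := by
  have hzero : ∀ p : (ℕ × ℕ) × (ℕ × ℕ), ¬ (p.1.1 + p.2.1 = k ∧ p.1.2 + p.2.2 = l) →
      fourSum (comulMap F (DirectSum.lof ℂ ℕ (fun n => Inv F n) k a))
          (comulMap F (DirectSum.lof ℂ ℕ (fun n => Inv F n) l b))
          (comulMap F (DirectSum.lof ℂ ℕ (fun n => Inv F n) k' c))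
          (comulMap F (DirectSum.lof ℂ ℕ (fun n => Inv F n) l' d)) p = 0 := by
    rintro ⟨⟨i, m⟩, j, r⟩ hp
    dsimp only at hp
    rw [fourSum, Finset.sum_eq_zero, mul_zero]
    intro x _
    refine Finset.sum_eq_zero fun y _ => Finset.sum_eq_zero fun z _ =>
      Finset.sum_eq_zero fun w _ => ?_
    by_cases h1 : i + j = k
    · rw [ev₂_comulMap_lof_of_ne (fun h2 => hp ⟨h1, h2⟩) z w, mul_zero, zero_mul]
    · rw [ev₂_comulMap_lof_of_ne h1 x y, zero_mul, zero_mul]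
  rw [mul_def, mul_def, mulMap_lof, mulMap_lof]
  by_cases h' : k' + l' = k + l
  -- The degrees `k' + l'` and `k + l` are only propositionally equal; the target of the second
  -- induction is moved to the latter.
  · have hcast : DirectSum.lof ℂ ℕ (fun n => Inv F n) (k' + l') (hcInd rfl (box k' l' c d)) =
        DirectSum.lof ℂ ℕ (fun n => Inv F n) (k + l) (hcInd h' (box k' l' c d)) := by
      have : ∀ n (h' : k' + l' = n),
          DirectSum.lof ℂ ℕ (fun n => Inv F n) (k' + l') (hcInd rfl (box k' l' c d)) =
            DirectSum.lof ℂ ℕ (fun n => Inv F n) n (hcInd h' (box k' l' c d)) := by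
        rintro n rfl
        rfl
      exact this _ h'
    rw [hcast, pairing_lof]
    simp only [ev_gl, DirectSum.lof_apply]
    refine (sum_hcIndFun_mul_hcIndFun rfl h' (box k l a b) (box k' l' c d)).trans ?_
    simp only [Position.fourSum_eq]
    refine Finset.sum_of_injOn (fun t => ((t.i, t.m), (t.j, t.r))) ?_ ?_ ?_ ?_
    · intro t _ t' _ htt
      exact Position.ext_i (congrArg (fun p : (ℕ × ℕ) × (ℕ × ℕ) => p.1.1) htt)
    · intro t _
      simp [t.him, t.hjr]
    · rintro ⟨⟨i, m⟩, j, r⟩ hp hp'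
      refine hzero _ fun hkl => hp' ?_
      simp only [Finset.mem_product, Finset.HasAntidiagonal.mem_antidiagonal] at hp
      exact ⟨⟨i, j, m, r, hkl.1, hkl.2, hp.1, hp.2⟩, by simp, rfl⟩
    · intro t _
      rfl
  · rw [pairing_lof_lof_of_ne (Ne.symm h'), Finset.sum_eq_zero]
    rintro ⟨⟨i, m⟩, j, r⟩ hp
    simp only [Finset.mem_product, Finset.HasAntidiagonal.mem_antidiagonal] at hp
    refine hzero _ fun hkl => h' ?_
    dsimp only at hkl
    omega

/-- Tested against homogeneous `h ⊗ t`, the left side is `⟨h t, a b⟩` by adjointness, and both sides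
become the same sum of contractions. -/
theorem comulMap_mul (a b : CSpace F) :
    (comulMap F (a * b) : CSpace F ⊗[ℂ] CSpace F) = comulMap F a * comulMap F b := by
  induction a using CSpace.induction with
  | zero => simp
  | add s t hs ht => rw [add_mul, map_add, hs, ht, map_add, add_mul]
  | lof k f =>
  induction b using CSpace.induction with
  | zero => simp
  | add s t hs ht => rw [mul_add, map_add, hs, ht, map_add, mul_add]
  | lof l g =>
  refine pairing₂_ext fun k' l' h t => ?_
  rw [← pairing_mulMap, pairing_comm, pairing₂_mul]
  exact pairing_mul_mul f g h t

end Mackey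

/-! ### The Hopf algebra structure -/

section Hopf

variable {F : Type*} [Field F] [Fintype F] [DecidableEq F]

theorem counitMap_eq_pairing_one (c : CSpace F) : counitMap F c = pairing F 1 c :=
  (LinearMap.congr_fun (congrArg WithConv.ofConv (toDual_one (F := F))) c).symm

omit [Fintype F] [DecidableEq F] in
theorem counitMap_one : counitMap F (1 : CSpace F) = 1 := by
  rw [one_def, counitMap, unitMap, LinearMap.comp_apply, LinearMap.comp_apply]
  rw [DirectSum.component.lof_self]
  exact (zeroEquiv F).apply_symm_apply 1

omit [DecidableEq F] in
theorem comulMap_one : comulMap F (1 : CSpace F) = 1 ⊗ₜ 1 := by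
  refine ev₂_ext fun i j x y => ?_
  by_cases h : i = 0 ∧ j = 0
  · obtain ⟨rfl, rfl⟩ := h
    have : Subsingleton (gl F (0 + 0)) := inferInstanceAs (Subsingleton (gl F 0))
    rw [ev₂_tmul, ev₂_comulMap, Fintype.sum_subsingleton _ 0,
      ← ev_blockUpper (rfl : 0 + 0 = 0), Subsingleton.elim x 0, Subsingleton.elim y 0,
      Subsingleton.elim (blockUpper _ _ _ _) 0, ← counit_eq_ev, counitMap_one]
    simp
  · have h1 : i + j ≠ 0 := by omega
    rw [one_def, unitMap, LinearMap.comp_apply, ev₂_comulMap_lof_of_ne h1, ev₂_tmul]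
    by_cases hi : i = 0
    · rw [ev_lof_of_ne (n := 0) (x := y) (by simp; tauto), mul_zero]
    · rw [ev_lof_of_ne (n := 0) (x := x) (by simpa using hi), zero_mul]

/-- The counit is the pairing with `1`, and `1` is grouplike, so adjointness gives multiplicativity.
-/
theorem counitMap_mul (a b : CSpace F) :
    counitMap F (a * b) = counitMap F a * counitMap F b := by
  rw [counitMap_eq_pairing_one, pairing_comm, mul_def, pairing_mulMap, comulMap_one, pairing₂_tmul,
    pairing_comm, pairing_comm b, ← counitMap_eq_pairing_one, ← counitMap_eq_pairing_one]

instance : Bialgebra ℂ (CSpace F) :=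
  Bialgebra.mk' ℂ (CSpace F) counitMap_one (counitMap_mul _ _) comulMap_one (comulMap_mul _ _)

omit [Fintype F] [DecidableEq F] in
theorem lof_mem_comp {n : ℕ} (f : Inv F n) :
    DirectSum.lof ℂ ℕ (fun n => Inv F n) n f ∈ comp F n := ⟨f, rfl⟩

omit [Fintype F] [DecidableEq F] in
theorem one_mem_comp : (1 : CSpace F) ∈ comp F 0 := lof_mem_comp _

theorem mul_mem_comp {i j : ℕ} {a b : CSpace F} (ha : a ∈ comp F i) (hb : b ∈ comp F j) :
    a * b ∈ comp F (i + j) := by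
  obtain ⟨f, rfl⟩ := ha
  obtain ⟨g, rfl⟩ := hb
  rw [mul_def, mulMap_lof]
  exact lof_mem_comp _

/-! ### The antipode as a geometric series for convolution -/

/-- Convolution of linear endomorphisms on a homogeneous element. -/
theorem conv_apply_lof (u v : WithConv (CSpace F →ₗ[ℂ] CSpace F)) {n : ℕ} (f : Inv F n) :
    (u * v) (DirectSum.lof ℂ ℕ (fun n => Inv F n) n f) =
      ∑ p : Finset.HasAntidiagonal.antidiagonal n, LinearMap.mul' ℂ (CSpace F)
        (TensorProduct.map (u.ofConv ∘ₗ DirectSum.lof ℂ ℕ (fun n => Inv F n) p.1.1)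
          (v.ofConv ∘ₗ DirectSum.lof ℂ ℕ (fun n => Inv F n) p.1.2)
          ((boxEquiv p.1.1 p.1.2).symm
            (hcRes (Finset.HasAntidiagonal.mem_antidiagonal.1 p.2) f))) := by
  rw [LinearMap.convMul_apply, comul_eq, comulMap, DirectSum.toModule_lof, LinearMap.sum_apply,
    map_sum, map_sum]
  simp only [TensorProduct.map_comp, LinearMap.comp_apply]
  rfl

theorem conv_congr {u u' v v' : WithConv (CSpace F →ₗ[ℂ] CSpace F)} {n : ℕ}
    (hu : ∀ m ≤ n, ∀ f, u (DirectSum.lof ℂ ℕ (fun n => Inv F n) m f) = u' (DirectSum.lof ℂ ℕ _ m f))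
    (hv : ∀ m ≤ n, ∀ f, v (DirectSum.lof ℂ ℕ (fun n => Inv F n) m f) = v' (DirectSum.lof ℂ ℕ _ m f))
    (f : Inv F n) : (u * v) (DirectSum.lof ℂ ℕ (fun n => Inv F n) n f) =
      (u' * v') (DirectSum.lof ℂ ℕ _ n f) := by
  rw [conv_apply_lof, conv_apply_lof]
  refine Finset.sum_congr rfl fun p _ => ?_
  have hp := Finset.HasAntidiagonal.mem_antidiagonal.1 p.2
  rw [show u.ofConv ∘ₗ DirectSum.lof ℂ ℕ (fun n => Inv F n) p.1.1 = u'.ofConv ∘ₗ _ from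
      LinearMap.ext (hu _ (by omega)),
    show v.ofConv ∘ₗ DirectSum.lof ℂ ℕ (fun n => Inv F n) p.1.2 = v'.ofConv ∘ₗ _ from
      LinearMap.ext (hv _ (by omega))]

theorem conv_mem_comp {u v : WithConv (CSpace F →ₗ[ℂ] CSpace F)}
    (hu : ∀ n f, u (DirectSum.lof ℂ ℕ (fun n => Inv F n) n f) ∈ comp F n)
    (hv : ∀ n f, v (DirectSum.lof ℂ ℕ (fun n => Inv F n) n f) ∈ comp F n) (n : ℕ) (f : Inv F n) :
    (u * v) (DirectSum.lof ℂ ℕ (fun n => Inv F n) n f) ∈ comp F n := by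
  rw [conv_apply_lof]
  refine Submodule.sum_mem _ fun p _ => ?_
  have hp := Finset.HasAntidiagonal.mem_antidiagonal.1 p.2
  generalize (boxEquiv p.1.1 p.1.2).symm
    (hcRes (Finset.HasAntidiagonal.mem_antidiagonal.1 p.2) f) = T
  induction T with
  | zero => rw [map_zero, map_zero]; exact Submodule.zero_mem _
  | add s t hs ht => rw [map_add, map_add]; exact Submodule.add_mem _ hs ht
  | tmul g h =>
    rw [TensorProduct.map_tmul, LinearMap.mul'_apply]
    have key := mul_mem_comp (hu _ g) (hv _ h)
    rwa [show comp F (p.1.1 + p.1.2) = comp F n from congrArg _ hp] at key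

/-- If `p + q = n < k + l`, then `p < k` or `q < l`, so one factor kills each term of the coproduct.
Applied to powers of `oneSubId`, this gives local nilpotence. -/
theorem conv_eq_zero {u v : WithConv (CSpace F →ₗ[ℂ] CSpace F)} {k l : ℕ}
    (hu : ∀ m < k, ∀ f, u (DirectSum.lof ℂ ℕ (fun n => Inv F n) m f) = 0)
    (hv : ∀ m < l, ∀ f, v (DirectSum.lof ℂ ℕ (fun n => Inv F n) m f) = 0) {n : ℕ} (hn : n < k + l)
    (f : Inv F n) : (u * v) (DirectSum.lof ℂ ℕ (fun n => Inv F n) n f) = 0 := by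
  rw [conv_apply_lof]
  refine Finset.sum_eq_zero fun p _ => ?_
  have hp := Finset.HasAntidiagonal.mem_antidiagonal.1 p.2
  by_cases h : p.1.1 < k
  · rw [show u.ofConv ∘ₗ DirectSum.lof ℂ ℕ (fun n => Inv F n) p.1.1 = 0 from
      LinearMap.ext (hu _ h), TensorProduct.map_zero_left, LinearMap.zero_apply, map_zero]
  · rw [show v.ofConv ∘ₗ DirectSum.lof ℂ ℕ (fun n => Inv F n) p.1.2 = 0 from
      LinearMap.ext (hv _ (by omega)), TensorProduct.map_zero_right, LinearMap.zero_apply, map_zero]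

variable (F) in
/-- The convolution difference of the unit and the identity, which vanishes in degree `0`. -/
def oneSubId : WithConv (CSpace F →ₗ[ℂ] CSpace F) := 1 - WithConv.toConv LinearMap.id

theorem algebraMap_counitMap_lof_zero (f : Inv F 0) :
    algebraMap ℂ (CSpace F) (counitMap F (DirectSum.lof ℂ ℕ (fun n => Inv F n) 0 f)) =
      DirectSum.lof ℂ ℕ (fun n => Inv F n) 0 f := by
  rw [algebraMap_eq, counitMap, LinearMap.comp_apply, DirectSum.component.lof_self, unitMap,
    LinearMap.comp_apply, LinearEquiv.coe_coe, LinearEquiv.coe_coe, LinearEquiv.symm_apply_apply]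

omit [Fintype F] [DecidableEq F] in
theorem counitMap_lof_of_ne {n : ℕ} (hn : n ≠ 0) (f : Inv F n) :
    counitMap F (DirectSum.lof ℂ ℕ (fun n => Inv F n) n f) = 0 := by
  rw [counit_eq_ev, ev_lof_of_ne (by simpa using hn.symm)]

theorem oneSubId_pow_lof_of_lt {m i : ℕ} (h : m < i) (f : Inv F m) :
    (oneSubId F ^ i) (DirectSum.lof ℂ ℕ (fun n => Inv F n) m f) = 0 := by
  induction i generalizing m with
  | zero => omega
  | succ i ih =>
    rw [pow_succ]
    refine conv_eq_zero (k := i) (l := 1) (fun m hm f => ih hm f) (fun m hm f => ?_) h f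
    obtain rfl : m = 0 := by omega
    change algebraMap ℂ (CSpace F) (counitMap F _) - _ = 0
    rw [algebraMap_counitMap_lof_zero]
    exact sub_self _

theorem one_conv_mem_comp (n : ℕ) (f : Inv F n) :
    (1 : WithConv (CSpace F →ₗ[ℂ] CSpace F)) (DirectSum.lof ℂ ℕ (fun n => Inv F n) n f) ∈
      comp F n := by
  change algebraMap ℂ (CSpace F) (counitMap F _) ∈ _
  by_cases hn : n = 0
  · subst hn
    rw [algebraMap_counitMap_lof_zero]
    exact lof_mem_comp f
  · rw [counitMap_lof_of_ne hn, map_zero]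
    exact Submodule.zero_mem _

theorem oneSubId_pow_mem_comp (i n : ℕ) (f : Inv F n) :
    (oneSubId F ^ i) (DirectSum.lof ℂ ℕ (fun n => Inv F n) n f) ∈ comp F n := by
  induction i generalizing n with
  | zero => rw [pow_zero]; exact one_conv_mem_comp n f
  | succ i ih =>
    rw [pow_succ]
    exact conv_mem_comp ih (fun n f => Submodule.sub_mem _ (one_conv_mem_comp n f) (lof_mem_comp f))
      n f

variable (F) in
/-- The antipode `∑ᵢ (1 - id)ⁱ`, a sum with finitely many nonzero terms in each degree. -/
def antipodeMap : CSpace F →ₗ[ℂ] CSpace F :=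
  DirectSum.toModule ℂ ℕ _ fun n =>
    (∑ i ∈ Finset.range (n + 1), oneSubId F ^ i).ofConv ∘ₗ DirectSum.lof ℂ ℕ (fun n => Inv F n) n

omit [Fintype F] [DecidableEq F] in
theorem sum_conv_apply {ι : Type*} (s : Finset ι) (u : ι → WithConv (CSpace F →ₗ[ℂ] CSpace F))
    (a : CSpace F) : (∑ i ∈ s, u i) a = ∑ i ∈ s, u i a := by
  classical
  induction s using Finset.induction_on with
  | empty => rfl
  | insert i s hi ih =>
    rw [Finset.sum_insert hi, Finset.sum_insert hi, ← ih]
    rfl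

/-- The terms beyond degree `m` vanish, so one truncation at `n` serves all degrees up to `n`.
Convolution in degree `n` involves only these. -/
theorem antipodeMap_lof {m n : ℕ} (h : m ≤ n) (f : Inv F m) :
    antipodeMap F (DirectSum.lof ℂ ℕ (fun n => Inv F n) m f) =
      (∑ i ∈ Finset.range (n + 1), oneSubId F ^ i) (DirectSum.lof ℂ ℕ (fun n => Inv F n) m f) := by
  rw [antipodeMap, DirectSum.toModule_lof, LinearMap.comp_apply, sum_conv_apply, sum_conv_apply]
  refine Finset.sum_subset (Finset.range_subset_range.2 (by omega)) fun i _ hi => ?_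
  exact oneSubId_pow_lof_of_lt (by simpa using hi) f

theorem antipodeMap_mem_comp {n : ℕ} {a : CSpace F} (ha : a ∈ comp F n) :
    antipodeMap F a ∈ comp F n := by
  obtain ⟨f, rfl⟩ := ha
  rw [antipodeMap_lof le_rfl, sum_conv_apply]
  exact Submodule.sum_mem _ fun i _ => oneSubId_pow_mem_comp i n f

theorem id_eq_one_sub : WithConv.toConv LinearMap.id = 1 - oneSubId F :=
  (sub_sub_cancel _ _).symm

omit [Fintype F] [DecidableEq F] in
theorem conv_ext {u v : WithConv (CSpace F →ₗ[ℂ] CSpace F)}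
    (h : ∀ n f, u (DirectSum.lof ℂ ℕ (fun n => Inv F n) n f) = v (DirectSum.lof ℂ ℕ _ n f)) :
    u = v :=
  WithConv.ofConv_injective <| DirectSum.linearMap_ext ℂ fun n => LinearMap.ext (h n)

/-- In degree `n` the antipode may be replaced by the truncated series. Multiplied by `id = 1 - (1 -
id)` it telescopes to `1 - (1 - id)ⁿ⁺¹`, whose last power vanishes there. -/
theorem antipodeMap_conv_id : WithConv.toConv (antipodeMap F) * WithConv.toConv LinearMap.id = 1 := by
  refine conv_ext fun n f => ?_
  refine (conv_congr (u := WithConv.toConv (antipodeMap F)) (v := WithConv.toConv LinearMap.id)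
    (u' := ∑ i ∈ Finset.range (n + 1), oneSubId F ^ i) (v' := WithConv.toConv LinearMap.id)
    (fun m hm f => antipodeMap_lof hm f) (fun _ _ _ => rfl) f).trans ?_
  rw [id_eq_one_sub, geom_sum_mul_neg]
  change _ - (oneSubId F ^ (n + 1)) _ = _
  rw [oneSubId_pow_lof_of_lt (Nat.lt_succ_self n), sub_zero]
  rfl

theorem id_conv_antipodeMap : WithConv.toConv LinearMap.id * WithConv.toConv (antipodeMap F) = 1 := by
  refine conv_ext fun n f => ?_
  refine (conv_congr (u := WithConv.toConv LinearMap.id) (v := WithConv.toConv (antipodeMap F))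
    (u' := WithConv.toConv LinearMap.id) (v' := ∑ i ∈ Finset.range (n + 1), oneSubId F ^ i)
    (fun _ _ _ => rfl) (fun m hm f => antipodeMap_lof hm f) f).trans ?_
  rw [id_eq_one_sub, mul_neg_geom_sum]
  change _ - (oneSubId F ^ (n + 1)) _ = _
  rw [oneSubId_pow_lof_of_lt (Nat.lt_succ_self n), sub_zero]
  rfl

instance : HopfAlgebra ℂ (CSpace F) where
  antipode := antipodeMap F
  mul_antipode_rTensor_comul := congrArg WithConv.ofConv antipodeMap_conv_id
  mul_antipode_lTensor_comul := congrArg WithConv.ofConv id_conv_antipodeMap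

/-! ### The grading and connectedness -/

omit [Fintype F] [DecidableEq F] in
theorem isInternal_comp : DirectSum.IsInternal (comp F) := by
  let A : CSpace F →ₗ[ℂ] ⨁ n, comp F n := DirectSum.toModule ℂ ℕ _ fun n =>
    DirectSum.lof ℂ ℕ (fun n => comp F n) n ∘ₗ
      (DirectSum.lof ℂ ℕ (fun n => Inv F n) n).rangeRestrict
  have h1 : A ∘ₗ DirectSum.coeLinearMap (comp F) = LinearMap.id := by
    refine DirectSum.linearMap_ext ℂ fun n => LinearMap.ext ?_
    rintro ⟨_, f, rfl⟩
    rw [LinearMap.comp_apply, LinearMap.comp_apply, DirectSum.coeLinearMap_lof,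
      DirectSum.toModule_lof]
    rfl
  have h2 : DirectSum.coeLinearMap (comp F) ∘ₗ A = LinearMap.id := by
    refine DirectSum.linearMap_ext ℂ fun n => LinearMap.ext fun f => ?_
    rw [LinearMap.comp_apply, LinearMap.comp_apply, DirectSum.toModule_lof]
    exact DirectSum.coeLinearMap_lof (comp F) n ⟨_, lof_mem_comp f⟩
  exact Function.bijective_iff_has_inverse.2 ⟨A, LinearMap.congr_fun h1, LinearMap.congr_fun h2⟩

omit [DecidableEq F] in
theorem comulMap_mem {n : ℕ} {a : CSpace F} (ha : a ∈ comp F n) :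
    comulMap F a ∈ ⨆ p ∈ Finset.HasAntidiagonal.antidiagonal n,
      LinearMap.range (TensorProduct.map (comp F p.1).subtype (comp F p.2).subtype) := by
  obtain ⟨f, rfl⟩ := ha
  rw [comulMap, DirectSum.toModule_lof, LinearMap.sum_apply]
  refine Submodule.sum_mem _ fun p _ => ?_
  refine Submodule.mem_iSup_of_mem p.1 (Submodule.mem_iSup_of_mem p.2 ?_)
  rw [LinearMap.comp_apply, LinearMap.comp_apply]
  generalize (boxEquiv p.1.1 p.1.2).symm.toLinearMap
    (hcRes (Finset.HasAntidiagonal.mem_antidiagonal.1 p.2) f) = T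
  induction T with
  | zero => rw [map_zero]; exact Submodule.zero_mem _
  | add s t hs ht => rw [map_add]; exact Submodule.add_mem _ hs ht
  | tmul g h => exact ⟨⟨_, lof_mem_comp g⟩ ⊗ₜ ⟨_, lof_mem_comp h⟩, rfl⟩

theorem isConnectedGradedHopf : IsConnectedGradedHopf ℂ (comp F) where
  isInternal := isInternal_comp
  one_mem := one_mem_comp
  mul_mem _ _ _ _ := mul_mem_comp
  comul_mem _ _ := comulMap_mem
  counit_eq_zero n a hn ha := by
    obtain ⟨f, rfl⟩ := ha
    exact counitMap_lof_of_ne hn f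
  antipode_mem _ _ := antipodeMap_mem_comp
  unit_injective := by
    refine Function.LeftInverse.injective (g := counitMap F) fun c => ?_
    rw [Algebra.algebraMap_eq_smul_one, map_smul, counitMap_one, smul_eq_mul, mul_one]
  unit_range := by
    ext a
    constructor
    · rintro ⟨c, rfl⟩
      rw [Algebra.linearMap_apply, Algebra.algebraMap_eq_smul_one]
      exact Submodule.smul_mem _ _ one_mem_comp
    · rintro ⟨f, rfl⟩
      exact ⟨_, algebraMap_counitMap_lof_zero f⟩

end Hopf

end GLInv

end

/-- The maps `mulMap`, `comulMap`, `unitMap`, `counitMap` on the vector space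
`C(q) = ⨁ₙ C(𝔤𝔩ₙ(F))` are the product, coproduct, unit and counit of a connected graded Hopf
algebra over `ℂ`, which is commutative and cocommutative. A Hopf algebra structure with these
structure maps is expressed as a Hopf algebra `H` with a linear isomorphism `φ : C(q) ≃ H` that
carries the four maps to those of `H`. -/
theorem mainTheorem4 (F : Type u) [Field F] [Fintype F] [DecidableEq F] :
    ∃ (H : Type u) (_ : CommRing H) (_ : HopfAlgebra ℂ H) (φ : GLInv.CSpace F ≃ₗ[ℂ] H),
      (∀ x y : GLInv.CSpace F, φ (GLInv.mulMap F (x ⊗ₜ[ℂ] y)) = φ x * φ y) ∧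
      (∀ c : ℂ, φ (GLInv.unitMap F c) = algebraMap ℂ H c) ∧
      (∀ x : GLInv.CSpace F, Coalgebra.comul (R := ℂ) (φ x) =
        TensorProduct.map φ.toLinearMap φ.toLinearMap (GLInv.comulMap F x)) ∧
      (∀ x : GLInv.CSpace F, Coalgebra.counit (R := ℂ) (φ x) = GLInv.counitMap F x) ∧
      GLInv.IsConnectedGradedHopf ℂ
        (fun n => (GLInv.comp F n).map φ.toLinearMap) ∧
      Coalgebra.IsCocomm ℂ H := by
  refine ⟨GLInv.CSpace F, inferInstance, inferInstance, LinearEquiv.refl ℂ _, fun x y => rfl,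
    fun c => (GLInv.algebraMap_eq c).symm, fun x => ?_, fun x => rfl, ?_, ?_⟩
  · exact (LinearMap.congr_fun TensorProduct.map_id (GLInv.comulMap F x)).symm
  · have h : (fun n => (GLInv.comp F n).map (LinearEquiv.refl ℂ (GLInv.CSpace F)).toLinearMap) =
        GLInv.comp F := funext fun n => Submodule.map_id _
    rw [h]
    exact GLInv.isConnectedGradedHopf
  · exact inferInstanceAs (Coalgebra.IsCocomm ℂ (GLInv.CSpace F))
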